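/- For a finite number $d$ of variables, vectors $\boldsymbol\alpha,\boldsymbol\beta\in[0,\infty)^d$ and $a>0$, let $(\mathcal S_a)^{\boldsymbol\alpha}_{\boldsymbol\beta}(\mathbb R^d)$ be the normed space of all smooth $\varphi:\mathbb R^d\to\mathbb C$ with $$\sigma_a(\varphi)=\sup_{t\in\mathbb R^d,\;p,q\in\mathbb N_0^d}\frac{a^{|p|+|q|}}{\prod_i p_i!^{\beta_i}\,q_i!^{\alpha_i}}\,|t^p\varphi^{(q)}(t)|<\infty ,$$ and let $\mathcal S^{\boldsymbol\alpha}_{\boldsymbol\beta}(\mathbb R^d)=\varinjlim_{a\to0}(\mathcal S_a)^{\boldsymbol\alpha}_{\boldsymbol\beta}(\mathbb R^d)$ be their inductive limit in the category of locally convex spaces. For real $\alpha,\beta\ge 0$ write $\mathcal S^\alpha_\beta(\mathbb R^n)$ for the space with all regularity exponents $\alpha_i=\alpha$ and all decay exponents $\beta_i=\beta$ (so $\mathcal S^\alpha_0(\mathbb R^k)$ consists of compactly supported functions). Write $\mathcal S^\alpha_\beta(\mathbb R^k\times\mathbb R^n)$ for the space of functions $\Phi(\tilde y,\xi)$ in which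 the variables $\tilde y\in\mathbb R^k$ have regularity exponent $\alpha$ and decay exponent $\beta$, and the frequency variables $\xi\in\mathbb R^n$ have regularity exponent $\beta$ and decay exponent $\alpha$; for $\alpha=\beta$ this is $\mathcal S^\alpha_\alpha(\mathbb R^{k+n})$. The spaces $\mathcal S'^\alpha_\beta$ are the corresponding strong duals. Let $k\ge1$, $\alpha,\beta>0$, let $u_1,\dots,u_k\in\mathbb S^{n-1}$ be linearly independent, $\mathbf u^k=(u_1,\dots,u_k)$, and let $g\in\mathcal S^\alpha_0(\mathbb R^k)$. For functions $f$ on $\mathbb R^n$ and $F$ on $\mathbb R^k\times\mathbb R^n$ put $$DS_{g,\mathbf u^k}f(\tilde y,\xi)=\int_{\mathbb R^n}f(t)\,\overline{g\big((u_1\cdot t,\dots,u_k\cdot t)-\tilde y\big)}\,e^{-2\pi i t\cdot\xi}\,dt,$$ $$DS^*_{g,\mathbf u^k}F(t)=\int_{\mathbb R^n}\int_{\mathbb R^k}F(\tilde y,\xi)\,g\big((u_1\cdot t,\dots,u_k\cdot t)-\tilde y\big)\,e^{2\pi i\xi\cdot t}\,d\tilde y\,d\xi .$$ Then, with absolutely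 convergent integrals, $DS_{\overline g,\mathbf u^k}$ is a continuous linear map $\mathcal S^\alpha_\beta(\mathbb R^n)\to\mathcal S^\alpha_\beta(\mathbb R^k\times\mathbb R^n)$ and $DS^*_{\overline g,\mathbf u^k}$ is a continuous linear map $\mathcal S^\alpha_\beta(\mathbb R^k\times\mathbb R^n)\to\mathcal S^\alpha_\beta(\mathbb R^n)$. Their transposes, given by $$\langle DS_{g,\mathbf u^k}f,\Phi\rangle=\langle f,DS^*_{\overline g,\mathbf u^k}\Phi\rangle,\qquad \langle DS^*_{g,\mathbf u^k}F,\varphi\rangle=\langle F,DS_{\overline g,\mathbf u^k}\varphi\rangle ,$$ are continuous linear maps of the strong duals $$DS_{g,\mathbf u^k}:\mathcal S'^\alpha_\beta(\mathbb R^n)\to\mathcal S'^\alpha_\beta(\mathbb R^k\times\mathbb R^n),\qquad DS^*_{g,\mathbf u^k}:\mathcal S'^\alpha_\beta(\mathbb R^k\times\mathbb R^n)\to\mathcal S'^\alpha_\beta(\mathbb R^n).$$ -/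

import Mathlib

open scoped ContDiff ENNReal

namespace GelfandShilov

/-- The partial derivative `∂φ/∂t_i` of a function on `ℝ^ι`. -/
noncomputable def pderiv {ι : Type} [Fintype ι] [DecidableEq ι] (i : ι)
    (φ : EuclideanSpace ℝ ι → ℂ) : EuclideanSpace ℝ ι → ℂ :=
  fun t => fderiv ℝ φ t (EuclideanSpace.single i (1 : ℝ))

/-- The partial derivative `φ^{(q)} = ∏ᵢ (∂/∂t_i)^{q_i} φ` for a multi-index `q`. The operators are
applied in the order of some fixed enumeration of `ι`; on smooth functions they commute. -/
noncomputable def multiDeriv {ι : Type} [Fintype ι] [DecidableEq ι] (q : ι → ℕ)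
    (φ : EuclideanSpace ℝ ι → ℂ) : EuclideanSpace ℝ ι → ℂ :=
  (Finset.univ : Finset ι).toList.foldr (fun i ψ => (pderiv i)^[q i] ψ) φ

/-- The monomial `t^p = ∏ᵢ t_i^{p_i}`. -/
def monomial {ι : Type} [Fintype ι] (p : ι → ℕ) (t : EuclideanSpace ℝ ι) : ℝ :=
  ∏ i, t i ^ p i

/-- The Gevrey weight `∏ᵢ (p_i!)^{γ_i}`; for constant `γ` it is `p!^γ`. -/
noncomputable def gevreyWeight {ι : Type} [Fintype ι] (γ : ι → ℝ) (p : ι → ℕ) : ℝ :=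
  ∏ i, (Nat.factorial (p i) : ℝ) ^ γ i

lemma gevreyWeight_nonneg {ι : Type} [Fintype ι] (γ : ι → ℝ) (p : ι → ℕ) :
    0 ≤ gevreyWeight γ p :=
  Finset.prod_nonneg fun _ _ => by positivity

/-- The norm
`σ_a(φ) = sup_{t,p,q} a^{|p|+|q|} / (p!^β q!^α) |t^p φ^{(q)}(t)|`, with values in `[0,∞]`.
Here `α i` is the regularity exponent and `β i` the decay exponent in the `i`-th coordinate. -/
noncomputable def gsNorm {ι : Type} [Fintype ι] [DecidableEq ι] (α β : ι → ℝ) (a : ℝ)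
    (φ : EuclideanSpace ℝ ι → ℂ) : ℝ≥0∞ :=
  ⨆ (t : EuclideanSpace ℝ ι) (p : ι → ℕ) (q : ι → ℕ),
    ENNReal.ofReal (a ^ ((∑ i, p i) + ∑ i, q i) / (gevreyWeight β p * gevreyWeight α q) *
      (|monomial p t| * ‖multiDeriv q φ t‖))

section LinearStructure

variable {ι : Type} [Fintype ι] [DecidableEq ι]

lemma pderiv_contDiff (i : ι) {φ : EuclideanSpace ℝ ι → ℂ} (hφ : ContDiff ℝ ∞ φ) :
    ContDiff ℝ ∞ (pderiv i φ) := by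
  have h : ContDiff ℝ ∞ (fderiv ℝ φ) := hφ.fderiv_right (m := ∞) (by simp)
  exact h.clm_apply contDiff_const

lemma pderiv_add (i : ι) {φ ψ : EuclideanSpace ℝ ι → ℂ} (hφ : ContDiff ℝ ∞ φ)
    (hψ : ContDiff ℝ ∞ ψ) : pderiv i (φ + ψ) = pderiv i φ + pderiv i ψ := by
  funext t
  have h1 := (hφ.differentiable (by simp)) t
  have h2 := (hψ.differentiable (by simp)) t
  simp [pderiv, fderiv_add h1 h2]

lemma pderiv_smul (i : ι) (c : ℂ) {φ : EuclideanSpace ℝ ι → ℂ} (hφ : ContDiff ℝ ∞ φ) :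
    pderiv i (c • φ) = c • pderiv i φ := by
  funext t
  have h1 := (hφ.differentiable (by simp)) t
  simp [pderiv, fderiv_const_smul h1 c]

lemma pderiv_iterate (i : ι) (m : ℕ) (c : ℂ) {φ ψ : EuclideanSpace ℝ ι → ℂ}
    (hφ : ContDiff ℝ ∞ φ) (hψ : ContDiff ℝ ∞ ψ) :
    ContDiff ℝ ∞ ((pderiv i)^[m] φ) ∧
      (pderiv i)^[m] (φ + ψ) = (pderiv i)^[m] φ + (pderiv i)^[m] ψ ∧
      (pderiv i)^[m] (c • φ) = c • (pderiv i)^[m] φ := by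
  induction m generalizing φ ψ with
  | zero => exact ⟨hφ, rfl, rfl⟩
  | succ m ih =>
    have h := ih (pderiv_contDiff i hφ) (pderiv_contDiff i hψ)
    simp only [Function.iterate_succ_apply]
    rw [pderiv_add i hφ hψ, pderiv_smul i c hφ]
    exact h

lemma multiDeriv_linear (q : ι → ℕ) (c : ℂ) {φ ψ : EuclideanSpace ℝ ι → ℂ}
    (hφ : ContDiff ℝ ∞ φ) (hψ : ContDiff ℝ ∞ ψ) :
    multiDeriv q (φ + ψ) = multiDeriv q φ + multiDeriv q ψ ∧
      multiDeriv q (c • φ) = c • multiDeriv q φ := by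
  unfold multiDeriv
  generalize (Finset.univ : Finset ι).toList = l
  have key : ContDiff ℝ ∞ (l.foldr (fun i ψ => (pderiv i)^[q i] ψ) φ) ∧
      ContDiff ℝ ∞ (l.foldr (fun i ψ => (pderiv i)^[q i] ψ) ψ) ∧
      l.foldr (fun i ψ => (pderiv i)^[q i] ψ) (φ + ψ) =
        l.foldr (fun i ψ => (pderiv i)^[q i] ψ) φ + l.foldr (fun i ψ => (pderiv i)^[q i] ψ) ψ ∧
      l.foldr (fun i ψ => (pderiv i)^[q i] ψ) (c • φ) =
        c • l.foldr (fun i ψ => (pderiv i)^[q i] ψ) φ := by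
    induction l with
    | nil => exact ⟨hφ, hψ, rfl, rfl⟩
    | cons i l ih =>
      obtain ⟨h1, h2, h3, h4⟩ := ih
      simp only [List.foldr_cons]
      rw [h3, h4]
      have hA := pderiv_iterate i (q i) c h1 h2
      exact ⟨hA.1, (pderiv_iterate i (q i) c h2 h1).1, hA.2.1, hA.2.2⟩
  exact key.2.2

lemma gsNorm_mono (α β : ι → ℝ) {a b : ℝ} (ha : 0 ≤ a) (hab : a ≤ b)
    (φ : EuclideanSpace ℝ ι → ℂ) : gsNorm α β a φ ≤ gsNorm α β b φ := by
  refine iSup_mono fun t => iSup_mono fun p => iSup_mono fun q => ENNReal.ofReal_le_ofReal ?_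
  have h1 := gevreyWeight_nonneg β p
  have h2 := gevreyWeight_nonneg α q
  gcongr

lemma gsNorm_add_le (α β : ι → ℝ) {a : ℝ} (ha : 0 ≤ a) {φ ψ : EuclideanSpace ℝ ι → ℂ}
    (hφ : ContDiff ℝ ∞ φ) (hψ : ContDiff ℝ ∞ ψ) :
    gsNorm α β a (φ + ψ) ≤ gsNorm α β a φ + gsNorm α β a ψ := by
  refine iSup_le fun t => iSup_le fun p => iSup_le fun q => ?_
  have h1 := gevreyWeight_nonneg β p
  have h2 := gevreyWeight_nonneg α q
  refine le_trans ?_ (add_le_add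
    (le_iSup_of_le t (le_iSup_of_le p (le_iSup_of_le q le_rfl)))
    (le_iSup_of_le t (le_iSup_of_le p (le_iSup_of_le q le_rfl))))
  rw [← ENNReal.ofReal_add (by positivity) (by positivity), (multiDeriv_linear q 0 hφ hψ).1,
    ← mul_add, ← mul_add]
  refine ENNReal.ofReal_le_ofReal ?_
  gcongr
  exact norm_add_le _ _

lemma gsNorm_smul_le (α β : ι → ℝ) (a : ℝ) (c : ℂ) {φ : EuclideanSpace ℝ ι → ℂ}
    (hφ : ContDiff ℝ ∞ φ) :
    gsNorm α β a (c • φ) ≤ ENNReal.ofReal ‖c‖ * gsNorm α β a φ := by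
  refine iSup_le fun t => iSup_le fun p => iSup_le fun q => ?_
  have hle : ENNReal.ofReal (a ^ ((∑ i, p i) + ∑ i, q i) /
      (gevreyWeight β p * gevreyWeight α q) * (|monomial p t| * ‖multiDeriv q φ t‖)) ≤
      gsNorm α β a φ := le_iSup_of_le t (le_iSup_of_le p (le_iSup_of_le q le_rfl))
  refine le_trans ?_ (mul_le_mul_right hle _)
  rw [← ENNReal.ofReal_mul (norm_nonneg c), (multiDeriv_linear q c hφ hφ).2]
  refine ENNReal.ofReal_le_ofReal (le_of_eq ?_)
  simp only [Pi.smul_apply, norm_smul]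
  ring

lemma gsNorm_zero (α β : ι → ℝ) (a : ℝ) :
    gsNorm α β a (0 : EuclideanSpace ℝ ι → ℂ) = 0 := by
  have h := gsNorm_smul_le α β a 0 (φ := (0 : EuclideanSpace ℝ ι → ℂ)) contDiff_const
  simpa using h

end LinearStructure

/-- The space `(𝒮_a)^α_β` of all smooth functions `φ` with `σ_a(φ) < ∞` (for `a > 0`). -/
def gsStep {ι : Type} [Fintype ι] [DecidableEq ι] (α β : ι → ℝ) (a : ℝ) :
    Set (EuclideanSpace ℝ ι → ℂ) :=
  {φ | ContDiff ℝ ∞ φ ∧ gsNorm α β a φ < ⊤}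

/-- The union of all the spaces `(𝒮_a)^α_β`, `a > 0`, as a vector space of functions. -/
def gsSubmodule {ι : Type} [Fintype ι] [DecidableEq ι] (α β : ι → ℝ) :
    Submodule ℂ (EuclideanSpace ℝ ι → ℂ) where
  carrier := {φ | ∃ a : ℝ, 0 < a ∧ φ ∈ gsStep α β a}
  zero_mem' := ⟨1, one_pos, contDiff_const, by rw [gsNorm_zero α β 1]; simp⟩
  add_mem' := by
    rintro φ ψ ⟨a, ha, hφ, hφa⟩ ⟨b, hb, hψ, hψb⟩
    have hm : 0 < min a b := lt_min ha hb
    refine ⟨min a b, hm, hφ.add hψ, lt_of_le_of_lt (gsNorm_add_le α β hm.le hφ hψ) ?_⟩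
    exact ENNReal.add_lt_top.2
      ⟨lt_of_le_of_lt (gsNorm_mono α β hm.le (min_le_left a b) φ) hφa,
        lt_of_le_of_lt (gsNorm_mono α β hm.le (min_le_right a b) ψ) hψb⟩
  smul_mem' := by
    rintro c φ ⟨a, ha, hφ, hφa⟩
    exact ⟨a, ha, hφ.const_smul c, lt_of_le_of_lt (gsNorm_smul_le α β a c hφ)
      (ENNReal.mul_lt_top ENNReal.ofReal_lt_top hφa)⟩

/-- The Gelfand–Shilov space (of Roumieu type) on `ℝ^ι` with regularity exponents `α` and decay
exponents `β`. It is a new type, so that it does not carry the topology of pointwise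
convergence. -/
def GSSpace {ι : Type} [Fintype ι] [DecidableEq ι] (α β : ι → ℝ) : Type :=
  gsSubmodule α β

section Instances

variable {ι : Type} [Fintype ι] [DecidableEq ι] (α β : ι → ℝ)

noncomputable instance : AddCommGroup (GSSpace α β) :=
  inferInstanceAs (AddCommGroup (gsSubmodule α β))

noncomputable instance : Module ℂ (GSSpace α β) :=
  inferInstanceAs (Module ℂ (gsSubmodule α β))

instance : CoeFun (GSSpace α β) (fun _ => EuclideanSpace ℝ ι → ℂ) where
  coe φ := Subtype.val φ

/-- The inductive limit topology, in the category of locally convex spaces: the finest locally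
convex vector space topology for which all the inclusions of the normed spaces `(𝒮_a)^α_β`, `a > 0`,
are continuous. (The inclusions are linear, so their continuity is continuity at `0`, which is
what is written out.) -/
noncomputable instance : TopologicalSpace (GSSpace α β) :=
  sInf {τ : TopologicalSpace (GSSpace α β) |
    (∀ a : ℝ, 0 < a → ∀ U ∈ @nhds _ τ (0 : GSSpace α β),
      ∃ δ : ℝ≥0∞, 0 < δ ∧ ∀ φ : GSSpace α β, gsNorm α β a φ < δ → φ ∈ U) ∧
    @IsTopologicalAddGroup (GSSpace α β) τ _ ∧
    @ContinuousSMul ℂ (GSSpace α β) _ _ τ ∧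
    @LocallyConvexSpace ℝ (GSSpace α β) _ _ _ _ τ}

instance : IsTopologicalAddGroup (GSSpace α β) :=
  topologicalAddGroup_sInf fun _ h => h.2.1

instance : ContinuousSMul ℂ (GSSpace α β) :=
  continuousSMul_sInf fun _ h => h.2.2.1

instance : LocallyConvexSpace ℝ (GSSpace α β) :=
  LocallyConvexSpace.sInf fun _ h => h.2.2.2

end Instances

/-- The space `𝒮^α_β(ℝ^n)`. -/
abbrev GS (n : ℕ) (α β : ℝ) : Type :=
  GSSpace (ι := Fin n) (fun _ => α) (fun _ => β)

/-- The space `𝒮^α_β(ℝ^k × ℝ^n)` of functions `Φ(y, ξ)`: the variable `y ∈ ℝ^k` has regularity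
exponent `α` and decay exponent `β`; the frequency variable `ξ ∈ ℝ^n` has regularity exponent `β`
and decay exponent `α`. -/
abbrev PhaseGS (k n : ℕ) (α β : ℝ) : Type :=
  GSSpace (ι := Fin k ⊕ Fin n) (Sum.elim (fun _ => α) (fun _ => β))
    (Sum.elim (fun _ => β) (fun _ => α))

/-- For equal exponents the space on `ℝ^k × ℝ^n` is the usual `𝒮^α_α(ℝ^{k+n})`. -/
lemma phaseGS_self (k n : ℕ) (α : ℝ) :
    PhaseGS k n α α = GSSpace (ι := Fin k ⊕ Fin n) (fun _ => α) (fun _ => α) := by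
  rw [PhaseGS, Sum.elim_lam_const_lam_const]

/-- The point `(y, ξ)` of `ℝ^k × ℝ^n = ℝ^{k+n}`. -/
def pair {k n : ℕ} (y : EuclideanSpace ℝ (Fin k)) (ξ : EuclideanSpace ℝ (Fin n)) :
    EuclideanSpace ℝ (Fin k ⊕ Fin n) :=
  WithLp.toLp 2 (Sum.elim y ξ)

/-- The vector `(u₁ · t, …, u_k · t)`. -/
noncomputable def dirs {k n : ℕ} (u : Fin k → EuclideanSpace ℝ (Fin n))
    (t : EuclideanSpace ℝ (Fin n)) : EuclideanSpace ℝ (Fin k) :=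
  WithLp.toLp 2 fun i => inner ℝ (u i) t

/-- The integrand of the `k`-directional short-time Fourier transform. -/
noncomputable def dstftIntegrand {k n : ℕ} (g : EuclideanSpace ℝ (Fin k) → ℂ)
    (u : Fin k → EuclideanSpace ℝ (Fin n)) (f : EuclideanSpace ℝ (Fin n) → ℂ)
    (y : EuclideanSpace ℝ (Fin k)) (ξ t : EuclideanSpace ℝ (Fin n)) : ℂ :=
  f t * (starRingEnd ℂ) (g (dirs u t - y)) *
    Complex.exp (-2 * Real.pi * Complex.I * (inner ℝ t ξ : ℝ))

/-- The `k`-directional short-time Fourier transform `DS_{g,u} f (y, ξ)` of a function `f`. -/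
noncomputable def dstft {k n : ℕ} (g : EuclideanSpace ℝ (Fin k) → ℂ)
    (u : Fin k → EuclideanSpace ℝ (Fin n)) (f : EuclideanSpace ℝ (Fin n) → ℂ)
    (y : EuclideanSpace ℝ (Fin k)) (ξ : EuclideanSpace ℝ (Fin n)) : ℂ :=
  ∫ t, dstftIntegrand g u f y ξ t

/-- The integrand of the `k`-directional synthesis operator. -/
noncomputable def dsoIntegrand {k n : ℕ} (g : EuclideanSpace ℝ (Fin k) → ℂ)
    (u : Fin k → EuclideanSpace ℝ (Fin n)) (F : EuclideanSpace ℝ (Fin k ⊕ Fin n) → ℂ)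
    (t : EuclideanSpace ℝ (Fin n)) (y : EuclideanSpace ℝ (Fin k))
    (ξ : EuclideanSpace ℝ (Fin n)) : ℂ :=
  F (pair y ξ) * g (dirs u t - y) *
    Complex.exp (2 * Real.pi * Complex.I * (inner ℝ ξ t : ℝ))

/-- The `k`-directional synthesis operator `DS^*_{g,u} F (t)` of a function `F` on `ℝ^k × ℝ^n`. -/
noncomputable def dso {k n : ℕ} (g : EuclideanSpace ℝ (Fin k) → ℂ)
    (u : Fin k → EuclideanSpace ℝ (Fin n)) (F : EuclideanSpace ℝ (Fin k ⊕ Fin n) → ℂ)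
    (t : EuclideanSpace ℝ (Fin n)) : ℂ :=
  ∫ ξ, ∫ y, dsoIntegrand g u F t y ξ

/-- The complex conjugate `ḡ` of a function `g`. -/
noncomputable def conjFun {E : Type} (g : E → ℂ) : E → ℂ :=
  fun s => (starRingEnd ℂ) (g s)

end GelfandShilov

/-! Both operators are cases of one oscillatory integral, `oscIntegral`: ∫ f(x) g(Ax + Bz) e^{2πi
b(x,z)} dx with A, B linear and b bilinear. For the transform, x = t and z = (y, ξ); for the
synthesis operator the roles are exchanged. A derivative in z either differentiates g or multiplies
f by a linear form (`pderiv_oscIntegral`). Multiplication by a linear form b(v, z) is, after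
integration by parts in x, a derivative falling on f or on g (`coord_mul_oscIntegral`). With f = φ,
repeated use of these rules expresses z^p ∂^q of the integral through integrals built from t^a φ^(b)
and g^(c), and the defining norms of φ and g estimate each of these. The one remaining operation,
multiplication of the transform by powers of y, uses the compact support of g: where the window does
not vanish, |y_i| is at most ‖t‖ plus a constant, so powers of y are paid for by the decay of φ.

The delicate point is the number of terms in which a derivative hits the monomial t^a, since each
such hit costs a factor a_j. A weight made for this recurrence (`mixedWeight`) absorbs these factors
as soon as α + β ≥ 1, and it agrees with the Gevrey weights up to geometric factors, which only
shrink the step parameter. If α ≥ 1, the condition α + β ≥ 1 holds. If α ≤ 1, a compactly supported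
g with Gevrey bounds of order α is zero (`eq_zero_of_regularity_le_one`), and both operators vanish.

The outcome is that every normed step is mapped boundedly into some step
(`exists_gsNorm_analysis_le`, `exists_gsNorm_synthesis_le`). By the universal property of the
inductive limit this is continuity (`continuous_of_gsNorm_le`), and transposes of continuous linear
maps are continuous for the strong topologies. -/

open scoped ContDiff ENNReal

namespace GelfandShilov

/-! ### Commuting partial derivatives, words of derivatives, and monomials times derivatives. -/

section Calculus

variable {ι : Type} [Fintype ι] [DecidableEq ι]

lemma pderiv_comm (i j : ι) {φ : EuclideanSpace ℝ ι → ℂ} (hφ : ContDiff ℝ ∞ φ) :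
    pderiv i (pderiv j φ) = pderiv j (pderiv i φ) := by
  have h2 : ContDiff ℝ ∞ (fderiv ℝ φ) := hφ.fderiv_right (m := ∞) (by simp)
  have key : ∀ (i j : ι) (t), pderiv i (pderiv j φ) t =
      fderiv ℝ (fderiv ℝ φ) t (EuclideanSpace.single i 1) (EuclideanSpace.single j 1) := by
    intro i j t
    have hd : DifferentiableAt ℝ (fderiv ℝ φ) t := (h2.differentiable (by simp)) t
    unfold pderiv
    rw [fderiv_clm_apply hd (differentiableAt_const _)]
    simp
  funext t
  rw [key, key]
  exact (hφ.contDiffAt.isSymmSndFDerivAt (by simpa using WithTop.coe_le_coe.2 (le_top : (2 : ℕ∞) ≤ ⊤))) _ _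

lemma pderiv_iterate_contDiff (i : ι) (m : ℕ) {φ : EuclideanSpace ℝ ι → ℂ}
    (hφ : ContDiff ℝ ∞ φ) : ContDiff ℝ ∞ ((pderiv i)^[m] φ) :=
  (pderiv_iterate i m 0 hφ hφ).1

lemma pderiv_comm_iterate (i j : ι) (m : ℕ) {φ : EuclideanSpace ℝ ι → ℂ}
    (hφ : ContDiff ℝ ∞ φ) : pderiv j ((pderiv i)^[m] φ) = (pderiv i)^[m] (pderiv j φ) := by
  induction m with
  | zero => rfl
  | succ m ih =>
    rw [Function.iterate_succ_apply', Function.iterate_succ_apply', ← ih,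
      pderiv_comm j i (pderiv_iterate_contDiff i m hφ)]

lemma foldr_pderiv_contDiff (q : ι → ℕ) (l : List ι) {φ : EuclideanSpace ℝ ι → ℂ}
    (hφ : ContDiff ℝ ∞ φ) :
    ContDiff ℝ ∞ (l.foldr (fun i ψ => (pderiv i)^[q i] ψ) φ) := by
  induction l with
  | nil => exact hφ
  | cons i l ih => exact pderiv_iterate_contDiff i _ ih

lemma multiDeriv_contDiff (q : ι → ℕ) {φ : EuclideanSpace ℝ ι → ℂ} (hφ : ContDiff ℝ ∞ φ) :
    ContDiff ℝ ∞ (multiDeriv q φ) :=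
  foldr_pderiv_contDiff q _ hφ

@[simp] lemma multiDeriv_zero (φ : EuclideanSpace ℝ ι → ℂ) : multiDeriv 0 φ = φ := by
  unfold multiDeriv
  generalize (Finset.univ : Finset ι).toList = l
  induction l with
  | nil => rfl
  | cons i l _ => simp

/-- The extra derivative commutes past the other factors of the fold until it reaches the slot of
`j`. Absence of repetitions in the enumeration ensures that this slot is unique, which is why the
induction treats the cases `j ∉ l` and `j ∈ l` together. -/
lemma pderiv_multiDeriv (j : ι) (q : ι → ℕ) {φ : EuclideanSpace ℝ ι → ℂ}
    (hφ : ContDiff ℝ ∞ φ) :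
    pderiv j (multiDeriv q φ) = multiDeriv (q + Pi.single j 1) φ := by
  have key : ∀ l : List ι, l.Nodup →
      (j ∉ l → l.foldr (fun i ψ => (pderiv i)^[(q + Pi.single j 1 : ι → ℕ) i] ψ) φ =
        l.foldr (fun i ψ => (pderiv i)^[q i] ψ) φ) ∧
      (j ∈ l → pderiv j (l.foldr (fun i ψ => (pderiv i)^[q i] ψ) φ) =
        l.foldr (fun i ψ => (pderiv i)^[(q + Pi.single j 1 : ι → ℕ) i] ψ) φ) := by
    intro l
    induction l with
    | nil => simp
    | cons i l ih =>
      intro hl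
      obtain ⟨hil, hl⟩ := List.nodup_cons.1 hl
      obtain ⟨h1, h2⟩ := ih hl
      constructor
      · intro hj
        simp only [List.mem_cons, not_or] at hj
        simp only [List.foldr_cons]
        rw [h1 hj.2]
        simp [Ne.symm hj.1]
      · intro hj
        simp only [List.foldr_cons]
        by_cases hij : j = i
        · subst hij
          rw [h1 hil, Pi.add_apply, Pi.single_eq_same, Function.iterate_succ_apply']
        · rw [pderiv_comm_iterate i j _ (foldr_pderiv_contDiff q l hφ),
            h2 (by simpa [hij] using hj)]
          simp [Ne.symm hij]
  exact (key _ (Finset.nodup_toList _)).2 (by simp)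

/-- The derivative along a word of coordinate directions, the first letter acting first. -/
noncomputable def wordDeriv : List ι → (EuclideanSpace ℝ ι → ℂ) → EuclideanSpace ℝ ι → ℂ
  | [], φ => φ
  | i :: w, φ => wordDeriv w (pderiv i φ)

lemma wordDeriv_append (w v : List ι) (φ : EuclideanSpace ℝ ι → ℂ) :
    wordDeriv (w ++ v) φ = wordDeriv v (wordDeriv w φ) := by
  induction w generalizing φ with
  | nil => rfl
  | cons i w ih => exact ih _

lemma wordDeriv_replicate (m : ℕ) (i : ι) (φ : EuclideanSpace ℝ ι → ℂ) :
    wordDeriv (List.replicate m i) φ = (pderiv i)^[m] φ := by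
  induction m generalizing φ with
  | zero => rfl
  | succ m ih => exact ih _

/-- Words allow induction on one derivative at a time, while the letter counts remember the
multi-index. -/
lemma exists_multiDeriv_eq_wordDeriv (q : ι → ℕ) :
    ∃ w : List ι, (∀ i, w.count i = q i) ∧ ∀ φ, multiDeriv q φ = wordDeriv w φ := by
  have key : ∀ l : List ι, l.Nodup → ∃ w : List ι,
      (∀ i, w.count i = if i ∈ l then q i else 0) ∧
      ∀ φ, l.foldr (fun i ψ => (pderiv i)^[q i] ψ) φ = wordDeriv w φ := by
    intro l
    induction l with
    | nil => exact fun _ => ⟨[], by simp, fun _ => rfl⟩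
    | cons i l ih =>
      intro hl
      obtain ⟨hil, hl⟩ := List.nodup_cons.1 hl
      obtain ⟨w, hw, hw'⟩ := ih hl
      refine ⟨w ++ List.replicate (q i) i, fun j => ?_, fun φ => ?_⟩
      · rw [List.count_append, hw, List.count_replicate]
        by_cases hji : j = i
        · subst hji; simp [hil]
        · simp [hji, Ne.symm hji]
      · rw [List.foldr_cons, hw', wordDeriv_append, wordDeriv_replicate]
  obtain ⟨w, hw, hw'⟩ := key _ (Finset.nodup_toList Finset.univ)
  exact ⟨w, by simpa using hw, hw'⟩

lemma wordDeriv_add (w : List ι) {φ ψ : EuclideanSpace ℝ ι → ℂ} (hφ : ContDiff ℝ ∞ φ)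
    (hψ : ContDiff ℝ ∞ ψ) : wordDeriv w (φ + ψ) = wordDeriv w φ + wordDeriv w ψ := by
  induction w generalizing φ ψ with
  | nil => rfl
  | cons i w ih =>
    simp only [wordDeriv]
    rw [pderiv_add i hφ hψ, ih (pderiv_contDiff i hφ) (pderiv_contDiff i hψ)]

lemma wordDeriv_smul (w : List ι) (c : ℂ) {φ : EuclideanSpace ℝ ι → ℂ} (hφ : ContDiff ℝ ∞ φ) :
    wordDeriv w (c • φ) = c • wordDeriv w φ := by
  induction w generalizing φ with
  | nil => rfl
  | cons i w ih =>
    simp only [wordDeriv]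
    rw [pderiv_smul i c hφ, ih (pderiv_contDiff i hφ)]

lemma wordDeriv_sum {κ : Type} (s : Finset κ) (w : List ι) {φ : κ → EuclideanSpace ℝ ι → ℂ}
    (hφ : ∀ k, ContDiff ℝ ∞ (φ k)) :
    wordDeriv w (∑ k ∈ s, φ k) = ∑ k ∈ s, wordDeriv w (φ k) := by
  classical
  induction s using Finset.induction_on with
  | empty =>
    have h := wordDeriv_smul w 0 (φ := (0 : EuclideanSpace ℝ ι → ℂ)) contDiff_const
    simpa using h
  | insert k s hk ih =>
    rw [Finset.sum_insert hk, Finset.sum_insert hk, wordDeriv_add w (hφ k), ih]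
    have : (∑ k ∈ s, φ k) = fun t => ∑ k ∈ s, φ k t := by funext t; simp
    rw [this]
    exact ContDiff.sum fun k _ => hφ k

lemma monomial_add_single (p : ι → ℕ) (j : ι) (m : ℕ) (t : EuclideanSpace ℝ ι) :
    monomial (p + Pi.single j m) t = t j ^ m * monomial p t := by
  unfold monomial
  have : ∀ i, t i ^ (p + Pi.single j m : ι → ℕ) i = (if i = j then t j ^ m else 1) * t i ^ p i := by
    intro i
    by_cases h : i = j
    · subst h; simp [pow_add, mul_comm]
    · simp [h]
  simp only [this, Finset.prod_mul_distrib]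
  simp

@[simp] lemma monomial_zero (t : EuclideanSpace ℝ ι) : monomial 0 t = 1 := by
  simp [monomial]

lemma hasFDerivAt_coord (j : ι) (t : EuclideanSpace ℝ ι) :
    HasFDerivAt (fun t : EuclideanSpace ℝ ι => t j) (EuclideanSpace.proj (𝕜 := ℝ) j) t :=
  (EuclideanSpace.proj j : EuclideanSpace ℝ ι →L[ℝ] ℝ).hasFDerivAt

lemma contDiff_monomial (p : ι → ℕ) : ContDiff ℝ ∞ (monomial p) := by
  unfold monomial
  refine contDiff_prod fun i _ => ContDiff.pow ?_ _
  exact (EuclideanSpace.proj i : EuclideanSpace ℝ ι →L[ℝ] ℝ).contDiff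

lemma fderiv_monomial_single (p : ι → ℕ) (j : ι) (t : EuclideanSpace ℝ ι) :
    fderiv ℝ (monomial p) t (EuclideanSpace.single j 1) =
      p j * monomial (p - Pi.single j 1) t := by
  have h : HasFDerivAt (monomial p) _ t :=
    HasFDerivAt.finsetProd (u := Finset.univ) (g := fun i (t : EuclideanSpace ℝ ι) => t i ^ p i)
      fun i _ => (hasFDerivAt_coord i t).pow (p i)
  rw [h.fderiv]
  simp only [FunLike.coe_sum, Finset.sum_apply, FunLike.coe_smul, Pi.smul_apply,
    PiLp.proj_apply, PiLp.single_apply, smul_eq_mul]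
  rw [Finset.sum_eq_single j (fun i _ hi => by simp [hi]) (by simp)]
  unfold monomial
  rw [← Finset.mul_prod_erase _ _ (Finset.mem_univ j)]
  have : ∏ i ∈ Finset.univ.erase j, t i ^ (p - Pi.single j 1 : ι → ℕ) i =
      ∏ i ∈ Finset.univ.erase j, t i ^ p i := by
    refine Finset.prod_congr rfl fun i hi => ?_
    simp [Finset.ne_of_mem_erase hi]
  rw [this]
  simp
  ring

/-- The function `t ↦ t^a φ^{(b)}(t)`. -/
noncomputable def monoDeriv (a b : ι → ℕ) (φ : EuclideanSpace ℝ ι → ℂ) :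
    EuclideanSpace ℝ ι → ℂ :=
  fun t => (monomial a t : ℂ) * multiDeriv b φ t

lemma monoDeriv_contDiff (a b : ι → ℕ) {φ : EuclideanSpace ℝ ι → ℂ} (hφ : ContDiff ℝ ∞ φ) :
    ContDiff ℝ ∞ (monoDeriv a b φ) :=
  (Complex.ofRealCLM.contDiff.comp (contDiff_monomial a)).mul (multiDeriv_contDiff b hφ)

@[simp] lemma monoDeriv_zero_zero (φ : EuclideanSpace ℝ ι → ℂ) : monoDeriv 0 0 φ = φ := by
  funext t; simp [monoDeriv]

lemma norm_monoDeriv (a b : ι → ℕ) (φ : EuclideanSpace ℝ ι → ℂ) (t : EuclideanSpace ℝ ι) :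
    ‖monoDeriv a b φ t‖ = |monomial a t| * ‖multiDeriv b φ t‖ := by
  simp [monoDeriv]

lemma coord_mul_monoDeriv (a b : ι → ℕ) (φ : EuclideanSpace ℝ ι → ℂ) (j : ι)
    (t : EuclideanSpace ℝ ι) :
    (t j : ℂ) * monoDeriv a b φ t = monoDeriv (a + Pi.single j 1) b φ t := by
  simp only [monoDeriv, monomial_add_single]
  push_cast
  ring

/-- Leibniz rule. When `a j = 0` the truncated subtraction gives a meaningless index, but its
coefficient is zero. -/
lemma pderiv_monoDeriv (a b : ι → ℕ) {φ : EuclideanSpace ℝ ι → ℂ} (hφ : ContDiff ℝ ∞ φ) (j : ι) :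
    pderiv j (monoDeriv a b φ) =
      (a j : ℂ) • monoDeriv (a - Pi.single j 1) b φ + monoDeriv a (b + Pi.single j 1) φ := by
  funext t
  have h1 : HasFDerivAt (fun t => (monomial a t : ℂ)) _ t :=
    (Complex.ofRealCLM.hasFDerivAt).comp t
      ((contDiff_monomial a).differentiable (by simp) t).hasFDerivAt
  have h2 := ((multiDeriv_contDiff b hφ).differentiable (by simp) t).hasFDerivAt
  have h3 : fderiv ℝ (monoDeriv a b φ) t = _ := (h1.mul h2).fderiv
  have h4 : fderiv ℝ (multiDeriv b φ) t (EuclideanSpace.single j 1) =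
    multiDeriv (b + Pi.single j 1) φ t := congrFun (pderiv_multiDeriv j b hφ) t
  simp only [pderiv, h3, monoDeriv, Pi.add_apply, Pi.smul_apply, add_apply,
    smul_apply, h4, ContinuousLinearMap.comp_apply,
    fderiv_monomial_single, Complex.ofRealCLM_apply, smul_eq_mul]
  push_cast
  ring

end Calculus

/-! ### Factorial inequalities and the mixed weight. -/

section Factorials

lemma factorial_add_le (m n : ℕ) :
    ((m + n).factorial : ℝ) ≤ 2 ^ (m + n) * (m.factorial * n.factorial) := by
  have h := Nat.add_choose_mul_factorial_mul_factorial m n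
  have h2 : ((m + n).choose n : ℝ) ≤ 2 ^ (m + n) := by
    exact_mod_cast Nat.choose_le_two_pow _ _
  rw [← h]
  push_cast
  rw [mul_assoc]
  gcongr

lemma factorial_mul_le_add (m n : ℕ) :
    ((m.factorial * n.factorial : ℕ) : ℝ) ≤ (m + n).factorial := by
  exact_mod_cast Nat.le_of_dvd (Nat.factorial_pos _) (Nat.factorial_mul_factorial_dvd_factorial_add m n)

lemma factorial_sum_le {ι : Type} (s : Finset ι) (p : ι → ℕ) :
    ((∑ i ∈ s, p i).factorial : ℝ) ≤
      (2 ^ s.card) ^ (∑ i ∈ s, p i) * ∏ i ∈ s, ((p i).factorial : ℝ) := by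
  classical
  induction s using Finset.induction_on with
  | empty => simp
  | insert j s hj ih =>
    rw [Finset.sum_insert hj, Finset.prod_insert hj, Finset.card_insert_of_notMem hj]
    set S := ∑ i ∈ s, p i
    set D := ∏ i ∈ s, ((p i).factorial : ℝ)
    have hD : 0 ≤ D := Finset.prod_nonneg fun _ _ => by positivity
    calc ((p j + S).factorial : ℝ) ≤ 2 ^ (p j + S) * ((p j).factorial * S.factorial) :=
          factorial_add_le _ _
      _ ≤ 2 ^ (p j + S) * ((p j).factorial * ((2 ^ s.card) ^ (p j + S) * D)) := by
          gcongr
          refine ih.trans ?_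
          gcongr
          · exact one_le_pow₀ (by norm_num)
          · omega
      _ = _ := by rw [pow_succ 2 s.card, mul_pow]; ring

lemma gevreyWeight_pos {ι : Type} [Fintype ι] (γ : ι → ℝ) (p : ι → ℕ) :
    0 < gevreyWeight γ p :=
  Finset.prod_pos fun _ _ => by positivity

lemma gevreyWeight_const {ι : Type} [Fintype ι] (γ : ℝ) (p : ι → ℕ) :
    gevreyWeight (fun _ => γ) p = (∏ i, ((p i).factorial : ℝ)) ^ γ :=
  Real.finsetProd_rpow _ _ (fun _ _ => by positivity) _

lemma gevreyWeight_const_le {ι : Type} [Fintype ι] {γ : ℝ} (hγ : 0 ≤ γ) (p : ι → ℕ) :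
    gevreyWeight (fun _ => γ) p ≤ ((∑ i, p i).factorial : ℝ) ^ γ := by
  rw [gevreyWeight_const]
  refine Real.rpow_le_rpow (Finset.prod_nonneg fun _ _ => by positivity) ?_ hγ
  exact_mod_cast Nat.le_of_dvd (Nat.factorial_pos _) (Nat.prod_factorial_dvd_factorial_sum _ _)

/-- Together with `gevreyWeight_const_le`, this shows that for constant exponents only the total
degree matters up to a geometric factor; all later estimates are therefore carried out with total
degrees. -/
lemma le_gevreyWeight_const {ι : Type} [Fintype ι] {γ : ℝ} (hγ : 0 ≤ γ) (p : ι → ℕ) :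
    ((∑ i, p i).factorial : ℝ) ^ γ ≤
      ((2 ^ Fintype.card ι : ℝ) ^ γ) ^ (∑ i, p i) * gevreyWeight (fun _ => γ) p := by
  rw [gevreyWeight_const, ← Real.rpow_natCast, ← Real.rpow_mul (by positivity), mul_comm γ,
    Real.rpow_mul (by positivity), Real.rpow_natCast, ← Real.mul_rpow (by positivity)
      (Finset.prod_nonneg fun _ _ => by positivity)]
  exact Real.rpow_le_rpow (by positivity) (factorial_sum_le _ _) hγ

lemma gevreyWeight_sumElim {κ ι : Type} [Fintype κ] [Fintype ι] (γ δ : ℝ) (p : κ ⊕ ι → ℕ) :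
    gevreyWeight (Sum.elim (fun _ => γ) (fun _ => δ)) p =
      gevreyWeight (fun _ => γ) (fun i => p (Sum.inl i)) *
        gevreyWeight (fun _ => δ) (fun i => p (Sum.inr i)) := by
  simp [gevreyWeight, Fintype.prod_sum_type]

lemma ascFactorial_le_ascFactorial {m n : ℕ} (h : m ≤ n) (s : ℕ) :
    m.ascFactorial s ≤ n.ascFactorial s := by
  induction s with
  | zero => simp
  | succ s ih =>
    rw [Nat.ascFactorial_succ, Nat.ascFactorial_succ]
    gcongr

/-- The weight `M!^θ₁ ((M + s)! / M!)^θ₂` -/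
noncomputable def mixedWeight (θ₁ θ₂ : ℝ) (M s : ℕ) : ℝ :=
  (M.factorial : ℝ) ^ θ₁ * ((M + 1).ascFactorial s : ℝ) ^ θ₂

lemma mixedWeight_nonneg (θ₁ θ₂ : ℝ) (M s : ℕ) : 0 ≤ mixedWeight θ₁ θ₂ M s := by
  unfold mixedWeight; positivity

/-- This inequality dictates the shape of the weight. Passing from M to M + 1 multiplies M!^θ₁ by (M
+ 1)^θ₁, and the ascending factorial also gains at least a factor M + 1, so the total gain is at
least (M + 1)^(θ₁ + θ₂). The plain weight M!^θ₁ s!^θ₂ would gain only (s + 1)^θ₂ from its second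
factor, which is too little when s is small compared with M. -/
lemma succ_mul_mixedWeight_le {θ₁ θ₂ : ℝ} (h₁ : 0 ≤ θ₁) (h₂ : 0 ≤ θ₂) (h : 1 ≤ θ₁ + θ₂)
    (M s : ℕ) : ((M + 1 : ℕ) : ℝ) * mixedWeight θ₁ θ₂ M s ≤ mixedWeight θ₁ θ₂ (M + 1) (s + 1) := by
  have hasc : (M + 1) * (M + 1).ascFactorial s ≤ (M + 1 + 1).ascFactorial (s + 1) := by
    have e1 := Nat.succ_ascFactorial (M + 1) s
    rw [Nat.ascFactorial_succ]
    calc (M + 1) * (M + 1).ascFactorial s ≤ (M + 1).succ.ascFactorial s * (M + 1 + s) := by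
          have : (M + 1).ascFactorial s ≤ (M + 1).succ.ascFactorial s :=
            ascFactorial_le_ascFactorial (Nat.le_succ _) s
          nlinarith
      _ ≤ _ := by rw [mul_comm]; gcongr; omega
  have h0 : (1 : ℝ) ≤ ((M + 1 : ℕ) : ℝ) := by simp
  calc ((M + 1 : ℕ) : ℝ) * mixedWeight θ₁ θ₂ M s
      ≤ ((M + 1 : ℕ) : ℝ) ^ (θ₁ + θ₂) * mixedWeight θ₁ θ₂ M s := by
        gcongr
        · exact mixedWeight_nonneg _ _ _ _
        · exact Real.self_le_rpow_of_one_le h0 h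
    _ = ((M + 1 : ℕ) * M.factorial : ℝ) ^ θ₁ *
          ((M + 1 : ℕ) * (M + 1).ascFactorial s : ℝ) ^ θ₂ := by
        rw [Real.mul_rpow (by positivity) (by positivity),
          Real.mul_rpow (by positivity) (by positivity), Real.rpow_add (by positivity)]
        unfold mixedWeight
        ring
    _ ≤ _ := by
        unfold mixedWeight
        rw [Nat.factorial_succ]
        push_cast
        gcongr
        exact_mod_cast hasc

lemma le_mixedWeight {θ₁ θ₂ : ℝ} (h₂ : 0 ≤ θ₂) (M s : ℕ) :
    (M.factorial : ℝ) ^ θ₁ * (s.factorial : ℝ) ^ θ₂ ≤ mixedWeight θ₁ θ₂ M s := by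
  unfold mixedWeight
  gcongr
  rw [← Nat.one_ascFactorial s]
  exact ascFactorial_le_ascFactorial (by omega) s

lemma mixedWeight_le {θ₁ θ₂ : ℝ} (h₂ : 0 ≤ θ₂) (M s : ℕ) :
    mixedWeight θ₁ θ₂ M s ≤
      ((2 : ℝ) ^ θ₂) ^ (M + s) * ((M.factorial : ℝ) ^ θ₁ * (s.factorial : ℝ) ^ θ₂) := by
  have h1 : ((M + 1).ascFactorial s : ℝ) ≤ 2 ^ (M + s) * s.factorial := by
    have h := factorial_add_le M s
    rw [← Nat.factorial_mul_ascFactorial] at h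
    push_cast at h
    have hM : (0 : ℝ) < M.factorial := by positivity
    nlinarith
  unfold mixedWeight
  calc _ ≤ (M.factorial : ℝ) ^ θ₁ * (2 ^ (M + s) * s.factorial) ^ θ₂ := by gcongr
    _ = _ := by
      rw [Real.mul_rpow (by positivity) (by positivity), ← Real.rpow_natCast,
        ← Real.rpow_natCast, ← Real.rpow_mul (by positivity), ← Real.rpow_mul (by positivity),
        mul_comm θ₂]
      ring

lemma factorial_add_rpow_le {γ : ℝ} (hγ : 0 ≤ γ) (m n : ℕ) :
    ((m + n).factorial : ℝ) ^ γ ≤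
      ((2 : ℝ) ^ γ) ^ (m + n) * ((m.factorial : ℝ) ^ γ * (n.factorial : ℝ) ^ γ) := by
  rw [← Real.mul_rpow (by positivity) (by positivity), ← Real.rpow_natCast,
    ← Real.rpow_mul (by positivity), mul_comm γ, Real.rpow_mul (by positivity),
    ← Real.mul_rpow (by positivity) (by positivity), Real.rpow_natCast]
  exact Real.rpow_le_rpow (by positivity) (factorial_add_le m n) hγ

lemma factorial_rpow_mul_le {γ : ℝ} (hγ : 0 ≤ γ) (m n : ℕ) :
    (m.factorial : ℝ) ^ γ * (n.factorial : ℝ) ^ γ ≤ ((m + n).factorial : ℝ) ^ γ := by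
  rw [← Real.mul_rpow (by positivity) (by positivity)]
  refine Real.rpow_le_rpow (by positivity) ?_ hγ
  exact_mod_cast factorial_mul_le_add m n

end Factorials

/-! ### Passing between the norms and pointwise bounds with polynomial decay. -/

section Bounds

variable {ι : Type} [Fintype ι] [DecidableEq ι]

lemma norm_le_sum_abs (t : EuclideanSpace ℝ ι) : ‖t‖ ≤ ∑ j, |t j| := by
  conv_lhs => rw [← (EuclideanSpace.basisFun ι ℝ).sum_repr t]
  refine (norm_sum_le _ _).trans (le_of_eq ?_)
  simp [norm_smul]

/-- Let m be the maximum of 1 and all |t_j|, the value 1 being attached to `none`. Then 1 + ‖t‖ ≤ (d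
+ 1) m, and m^Q is one of the summands on the right. -/
lemma one_add_norm_pow_le (t : EuclideanSpace ℝ ι) (Q : ℕ) :
    (1 + ‖t‖) ^ Q ≤ (Fintype.card ι + 1) ^ Q * (1 + ∑ j, |t j| ^ Q) := by
  obtain ⟨j₀, hj₀⟩ := Finite.exists_max (fun o : Option ι => o.elim 1 fun j => |t j|)
  set m := (j₀.elim 1 fun j => |t j|) with hm
  have h1 : 1 ≤ m := hj₀ none
  have hS : ∑ j, |t j| ≤ Fintype.card ι * m := by
    simpa using Finset.sum_le_card_nsmul Finset.univ (fun j => |t j|) m fun j _ => hj₀ (some j)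
  have hn := norm_le_sum_abs t
  have h2 : 1 + ‖t‖ ≤ (Fintype.card ι + 1) * m := by linarith
  have h3 : m ^ Q ≤ 1 + ∑ j, |t j| ^ Q := by
    rcases j₀ with _ | j
    · have : 0 ≤ ∑ j, |t j| ^ Q := Finset.sum_nonneg fun _ _ => by positivity
      simp only [hm, Option.elim_none, one_pow]
      linarith
    · have : |t j| ^ Q ≤ ∑ j, |t j| ^ Q :=
        Finset.single_le_sum (f := fun j => |t j| ^ Q) (fun _ _ => by positivity)
          (Finset.mem_univ j)
      simp only [hm, Option.elim_some]
      linarith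
  calc (1 + ‖t‖) ^ Q ≤ ((Fintype.card ι + 1) * m) ^ Q := by gcongr
    _ = (Fintype.card ι + 1) ^ Q * m ^ Q := mul_pow _ _ _
    _ ≤ _ := by gcongr

variable {α β : ι → ℝ} {a : ℝ} {φ : EuclideanSpace ℝ ι → ℂ}

lemma norm_monoDeriv_le (ha : 0 < a) (hφ : gsNorm α β a φ < ⊤) (p q : ι → ℕ)
    (t : EuclideanSpace ℝ ι) :
    ‖monoDeriv p q φ t‖ ≤ (gsNorm α β a φ).toReal * a⁻¹ ^ ((∑ i, p i) + ∑ i, q i) *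
      (gevreyWeight β p * gevreyWeight α q) := by
  have hle : ENNReal.ofReal (a ^ ((∑ i, p i) + ∑ i, q i) /
      (gevreyWeight β p * gevreyWeight α q) * (|monomial p t| * ‖multiDeriv q φ t‖)) ≤
      gsNorm α β a φ := le_iSup_of_le t (le_iSup_of_le p (le_iSup_of_le q le_rfl))
  have h := (ENNReal.ofReal_le_iff_le_toReal hφ.ne).1 hle
  have hp := gevreyWeight_pos β p
  have hq := gevreyWeight_pos α q
  rw [norm_monoDeriv]
  rw [div_mul_eq_mul_div, div_le_iff₀ (by positivity)] at h
  have hpow : (0 : ℝ) < a ^ ((∑ i, p i) + ∑ i, q i) := by positivity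
  rw [inv_pow, mul_right_comm, ← div_eq_mul_inv, le_div_iff₀ hpow]
  linarith

lemma gsNorm_le_of_norm_monoDeriv_le (ha : 0 < a) {K : ℝ}
    (h : ∀ p q t, ‖monoDeriv p q φ t‖ ≤ K * a⁻¹ ^ ((∑ i, p i) + ∑ i, q i) *
      (gevreyWeight β p * gevreyWeight α q)) : gsNorm α β a φ ≤ ENNReal.ofReal K := by
  refine iSup_le fun t => iSup_le fun p => iSup_le fun q => ENNReal.ofReal_le_ofReal ?_
  have hp := gevreyWeight_pos β p
  have hq := gevreyWeight_pos α q
  have h := h p q t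
  have hpow : (0 : ℝ) < a ^ ((∑ i, p i) + ∑ i, q i) := by positivity
  rw [norm_monoDeriv, inv_pow, mul_right_comm, ← div_eq_mul_inv, le_div_iff₀ hpow] at h
  rw [div_mul_eq_mul_div, div_le_iff₀ (by positivity)]
  linarith

/-- The radial weight is replaced by pure powers |t_j|^Q, each of which only raises the monomial
index to p + Q e_j, so the norm applies directly. The assumption `a ≤ 1` makes powers of `a⁻¹`
increasing, so one exponent serves all terms. -/
lemma one_add_norm_pow_mul_monoDeriv_le (ha : 0 < a) (ha1 : a ≤ 1) (hφ : gsNorm α β a φ < ⊤)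
    (Q : ℕ) (p q : ι → ℕ) (t : EuclideanSpace ℝ ι) :
    (1 + ‖t‖) ^ Q * ‖monoDeriv p q φ t‖ ≤
      (Fintype.card ι + 1) ^ Q * (gsNorm α β a φ).toReal *
        a⁻¹ ^ ((∑ i, p i) + Q + ∑ i, q i) * gevreyWeight α q *
        (gevreyWeight β p + ∑ j, gevreyWeight β (p + Pi.single j Q)) := by
  have hA : 1 ≤ a⁻¹ := (one_le_inv₀ ha).2 ha1
  have hsplit : (1 + ‖t‖) ^ Q * ‖monoDeriv p q φ t‖ ≤ (Fintype.card ι + 1) ^ Q *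
      (‖monoDeriv p q φ t‖ + ∑ j, ‖monoDeriv (p + Pi.single j Q) q φ t‖) := by
    have : ∀ j, ‖monoDeriv (p + Pi.single j Q) q φ t‖ = |t j| ^ Q * ‖monoDeriv p q φ t‖ := by
      intro j
      rw [norm_monoDeriv, norm_monoDeriv, monomial_add_single, abs_mul, abs_pow, mul_assoc]
    simp only [this, ← Finset.sum_mul]
    have h := mul_le_mul_of_nonneg_right (one_add_norm_pow_le t Q)
      (norm_nonneg (monoDeriv p q φ t))
    linarith
  refine hsplit.trans ?_
  rw [mul_assoc, mul_assoc, mul_assoc]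
  gcongr
  have h0 : ‖monoDeriv p q φ t‖ ≤ (gsNorm α β a φ).toReal *
      a⁻¹ ^ ((∑ i, p i) + Q + ∑ i, q i) * gevreyWeight α q * gevreyWeight β p := by
    refine (norm_monoDeriv_le ha hφ p q t).trans ?_
    have hp := gevreyWeight_pos β p
    have hq := gevreyWeight_pos α q
    rw [mul_comm (gevreyWeight β p), ← mul_assoc]
    gcongr
    omega
  have h1 : ∀ j, ‖monoDeriv (p + Pi.single j Q) q φ t‖ ≤ (gsNorm α β a φ).toReal *
      a⁻¹ ^ ((∑ i, p i) + Q + ∑ i, q i) * gevreyWeight α q *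
        gevreyWeight β (p + Pi.single j Q) := by
    intro j
    have h := norm_monoDeriv_le ha hφ (p + Pi.single j Q) q t
    have : ∑ i, (p + Pi.single j Q : ι → ℕ) i = (∑ i, p i) + Q := by
      simp [Finset.sum_add_distrib]
    rwa [this, mul_comm (gevreyWeight β _), ← mul_assoc] at h
  calc _ ≤ _ + ∑ j, _ := add_le_add h0 (Finset.sum_le_sum fun j _ => h1 j)
    _ = _ := by rw [← Finset.mul_sum]; ring

end Bounds

/-! ### Windows with decay exponent zero: compact support, and vanishing for regularity exponent at
most one. -/

section Vanishing

/-- A chain of iterated derivatives with Gevrey bounds of order one and vanishing on a left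
half-line vanishes identically. -/
lemma eq_zero_of_gevrey_one {h : ℕ → ℝ → ℂ} {M A x₀ : ℝ} (hA : 0 < A)
    (hder : ∀ m x, HasDerivAt (h m) (h (m + 1) x) x)
    (hbd : ∀ m x, ‖h m x‖ ≤ M * A ^ m * m.factorial)
    (hzero : ∀ m, ∀ x ≤ x₀, h m x = 0) (m : ℕ) (x : ℝ) : h m x = 0 := by
  have hM : 0 ≤ M := by simpa using (norm_nonneg _).trans (hbd 0 0)
  -- Taylor's remainder estimate at a point of infinite-order vanishing, obtained by integrating the
  -- bound on the derivative of order m + j successively j times.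
  have taylor : ∀ y₀, (∀ m, h m y₀ = 0) → ∀ j m x, y₀ ≤ x →
      ‖h m x‖ ≤ M * A ^ (m + j) * (m + j).factorial * ((x - y₀) ^ j / j.factorial) := by
    intro y₀ hy j
    induction j with
    | zero => intro m x _; simpa using hbd m x
    | succ j ih =>
      intro m x hx
      set K := M * A ^ (m + (j + 1)) * (m + (j + 1)).factorial with hK
      have hB : ∀ s, HasDerivAt (fun s => K * ((s - y₀) ^ (j + 1) / (j + 1).factorial))
          (K * ((s - y₀) ^ j / j.factorial)) s := by
        intro s
        have h1 := ((((hasDerivAt_id s).sub_const y₀).pow (j + 1)).div_const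
          ((j + 1).factorial : ℝ)).const_mul K
        refine h1.congr_deriv ?_
        rw [Nat.factorial_succ]
        push_cast
        field_simp
        simp
      refine image_norm_le_of_norm_deriv_right_le_deriv_boundary (f' := h (m + 1))
        (fun s _ => (hder m s).continuousAt.continuousWithinAt)
        (fun s _ => (hder m s).hasDerivWithinAt) (by simp [hy]) hB (fun s hs => ?_)
        (Set.right_mem_Icc.2 hx)
      have := ih (m + 1) s hs.1
      rwa [show m + 1 + j = m + (j + 1) by ring] at this
  -- As (m + j)!/j! ≤ 2^(m + j) m!, the remainder is a constant times (2A(x - y₀))^j. The step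
  -- length 1/(4A) makes this at most 2^(-j), independently of y₀, so finitely many steps reach any
  -- point.
  have step : ∀ y₀, (∀ m, h m y₀ = 0) → ∀ m x, y₀ ≤ x → x ≤ y₀ + (4 * A)⁻¹ → h m x = 0 := by
    intro y₀ hy m x hx hx'
    have hbound : ∀ j : ℕ, ‖h m x‖ ≤ M * A ^ m * m.factorial * 2 ^ m * (1 / 2) ^ j := by
      intro j
      refine (taylor y₀ hy j m x hx).trans ?_
      have h1 : (A * (x - y₀)) ^ j ≤ (1 / 4) ^ j := by
        refine pow_le_pow_left₀ (by nlinarith) ?_ j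
        calc A * (x - y₀) ≤ A * (4 * A)⁻¹ := by gcongr; linarith
          _ = 1 / 4 := by field_simp
      have h2 : ((m + j).factorial : ℝ) / j.factorial ≤ 2 ^ (m + j) * m.factorial := by
        rw [div_le_iff₀ (by positivity), mul_assoc]
        exact factorial_add_le m j
      calc M * A ^ (m + j) * (m + j).factorial * ((x - y₀) ^ j / j.factorial)
          = M * A ^ m * (((m + j).factorial : ℝ) / j.factorial) * (A * (x - y₀)) ^ j := by
            rw [mul_pow, pow_add]; ring
        _ ≤ M * A ^ m * (2 ^ (m + j) * m.factorial) * (1 / 4) ^ j := by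
            have : 0 ≤ A * (x - y₀) := by nlinarith
            gcongr
        _ = _ := by
            rw [show (1 / 4 : ℝ) = 1 / 2 * (1 / 2) by norm_num, mul_pow, pow_add]
            have : (2 : ℝ) ^ j * (1 / 2) ^ j = 1 := by rw [← mul_pow]; norm_num
            linear_combination (M * A ^ m * 2 ^ m * m.factorial * (1 / 2) ^ j) * this
    have hlim : Filter.Tendsto (fun j : ℕ => M * A ^ m * m.factorial * 2 ^ m * (1 / 2 : ℝ) ^ j)
        Filter.atTop (nhds (M * A ^ m * m.factorial * 2 ^ m * 0)) :=
      (tendsto_pow_atTop_nhds_zero_of_lt_one (by norm_num) (by norm_num)).const_mul _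
    have := ge_of_tendsto' hlim hbound
    rw [mul_zero] at this
    exact norm_le_zero_iff.1 this
  have hd : 0 < (4 * A)⁻¹ := by positivity
  have all : ∀ N : ℕ, ∀ m, ∀ x ≤ x₀ + N * (4 * A)⁻¹, h m x = 0 := by
    intro N
    induction N with
    | zero => simpa using hzero
    | succ N ih =>
      intro m x hx
      rcases le_total x (x₀ + N * (4 * A)⁻¹) with h1 | h1
      · exact ih m x h1
      · refine step _ (fun m => ih m _ le_rfl) m x h1 (hx.trans (le_of_eq ?_))
        push_cast; ring
  obtain ⟨N, hN⟩ := exists_nat_ge ((x - x₀) / (4 * A)⁻¹)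
  refine all N m x ?_
  rw [div_le_iff₀ hd] at hN
  linarith

variable {ι : Type} [Fintype ι] [DecidableEq ι]

/-- With no factorial on the decay side, (a|s_i|)^m ‖g^(q)(s)‖ stays bounded as m grows; since
a|s_i| > 1, this forces g^(q)(s) = 0. -/
lemma eq_zero_of_decay_zero {α : ι → ℝ} {a : ℝ} {g : EuclideanSpace ℝ ι → ℂ} (ha : 0 < a)
    (hg : gsNorm α (fun _ => 0) a g < ⊤) (i : ι) (q : ι → ℕ) (s : EuclideanSpace ℝ ι)
    (hs : a⁻¹ < |s i|) : multiDeriv q g s = 0 := by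
  set C := (gsNorm α (fun _ => 0) a g).toReal * a⁻¹ ^ (∑ i, q i) * gevreyWeight α q
  have hb : ∀ m : ℕ, (|s i| * a) ^ m * ‖multiDeriv q g s‖ ≤ C := by
    intro m
    have h := norm_monoDeriv_le ha hg (Pi.single i m) q s
    have e1 : ∑ j, (Pi.single i m : ι → ℕ) j = m := by simp
    have e2 : monomial (Pi.single i m) s = s i ^ m := by
      simpa using monomial_add_single 0 i m s
    have e3 : gevreyWeight (fun _ => (0 : ℝ)) (Pi.single i m : ι → ℕ) = 1 := by simp [gevreyWeight]
    rw [norm_monoDeriv, e1, e2, e3, abs_pow, one_mul, pow_add] at h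
    have h' := mul_le_mul_of_nonneg_left h (pow_nonneg ha.le m)
    have e4 : a ^ m * a⁻¹ ^ m = 1 := by rw [← mul_pow, mul_inv_cancel₀ ha.ne', one_pow]
    calc (|s i| * a) ^ m * ‖multiDeriv q g s‖ = a ^ m * (|s i| ^ m * ‖multiDeriv q g s‖) := by
          rw [mul_pow]; ring
      _ ≤ _ := h'
      _ = (a ^ m * a⁻¹ ^ m) * C := by ring
      _ = C := by rw [e4, one_mul]
  have h1 : 1 < |s i| * a := by
    rwa [inv_eq_one_div, div_lt_iff₀ ha] at hs
  by_contra hne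
  have hpos : 0 < ‖multiDeriv q g s‖ := norm_pos_iff.2 hne
  obtain ⟨m, hm⟩ := pow_unbounded_of_one_lt (C / ‖multiDeriv q g s‖) h1
  rw [div_lt_iff₀ hpos] at hm
  exact absurd (hb m) (not_le.2 hm)

/-- For α ≤ 1 one has m!^α ≤ m!, so on each line parallel to a coordinate axis g is quasi-analytic
and vanishes on a half-line. Nonemptiness of `ι` supplies such a line; on a single point nonzero
constants would survive. -/
lemma eq_zero_of_regularity_le_one [Nonempty ι] {α a : ℝ} (hα : α ≤ 1)
    {g : EuclideanSpace ℝ ι → ℂ} (hsm : ContDiff ℝ ∞ g) (ha : 0 < a)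
    (hg : gsNorm (fun _ => α) (fun _ => 0) a g < ⊤) : g = 0 := by
  obtain ⟨i⟩ := ‹Nonempty ι›
  funext s
  set e : EuclideanSpace ℝ ι := EuclideanSpace.single i 1
  have hder : ∀ (m : ℕ) (x : ℝ), HasDerivAt
      (fun x : ℝ => multiDeriv (Pi.single i m) g (s + x • e))
      (multiDeriv (Pi.single i (m + 1)) g (s + x • e)) x := by
    intro m x
    have h1 := ((multiDeriv_contDiff (Pi.single i m) hsm).differentiable (by simp)
      (s + x • e)).hasFDerivAt
    have h2 : HasDerivAt (fun x : ℝ => s + x • e) e x := by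
      simpa using ((hasDerivAt_id x).smul_const e).const_add s
    have h3 := h1.comp_hasDerivAt x h2
    have h4 := congrFun (pderiv_multiDeriv i (Pi.single i m) hsm) (s + x • e)
    rw [← Pi.single_add] at h4
    rw [← h4]
    exact h3
  have hbd : ∀ (m : ℕ) (x : ℝ), ‖multiDeriv (Pi.single i m) g (s + x • e)‖ ≤
      (gsNorm (fun _ => α) (fun _ => 0) a g).toReal * a⁻¹ ^ m * m.factorial := by
    intro m x
    have h := norm_monoDeriv_le ha hg 0 (Pi.single i m) (s + x • e)
    rw [norm_monoDeriv, monomial_zero, abs_one, one_mul] at h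
    refine h.trans ?_
    have e1 : ∑ j, (Pi.single i m : ι → ℕ) j = m := by simp
    have e3 : gevreyWeight (fun _ => (0 : ℝ)) (0 : ι → ℕ) = 1 := by simp [gevreyWeight]
    have e4 : gevreyWeight (fun _ => α) (Pi.single i m : ι → ℕ) = (m.factorial : ℝ) ^ α := by
      unfold gevreyWeight
      rw [Finset.prod_eq_single i (fun j _ hj => by simp [hj]) (by simp)]
      simp
    have e5 : (m.factorial : ℝ) ^ α ≤ m.factorial := by
      have h1 : (1 : ℝ) ≤ m.factorial := by exact_mod_cast Nat.factorial_pos m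
      simpa using Real.rpow_le_rpow_of_exponent_le h1 hα
    rw [e1, e3, e4]
    simp only [Pi.zero_apply, Finset.sum_const_zero, zero_add, one_mul]
    gcongr
  -- For these x the coordinate s_i + x lies below -a⁻¹, outside the support.
  have hz : ∀ (m : ℕ), ∀ x ≤ -(a⁻¹ + |s i| + 1),
      multiDeriv (Pi.single i m) g (s + x • e) = 0 := by
    intro m x hx
    refine eq_zero_of_decay_zero ha hg i _ _ ?_
    have : (s + x • e) i = s i + x := by simp [e]
    rw [this]
    have h1 : 0 < a⁻¹ := by positivity
    have h2 := le_abs_self (s i)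
    rw [abs_of_neg (by linarith)]
    linarith
  have := eq_zero_of_gevrey_one (inv_pos.2 ha) hder hbd hz 0 0
  simpa using this

lemma hasCompactSupport_multiDeriv_of_decay_zero {α : ι → ℝ} {a : ℝ}
    {g : EuclideanSpace ℝ ι → ℂ} (ha : 0 < a) (hg : gsNorm α (fun _ => 0) a g < ⊤)
    (q : ι → ℕ) : HasCompactSupport (multiDeriv q g) := by
  refine HasCompactSupport.of_support_subset_isCompact
    (isCompact_closedBall (0 : EuclideanSpace ℝ ι) (∑ _j : ι, a⁻¹)) fun s hs => ?_
  rw [mem_closedBall_zero_iff]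
  refine (norm_le_sum_abs s).trans (Finset.sum_le_sum fun i _ => ?_)
  by_contra hlt
  exact hs (eq_zero_of_decay_zero ha hg i q s (not_le.1 hlt))

end Vanishing

/-! ### Oscillatory integrals with a compactly supported window: smoothness and integration by
parts. -/

section OscillatoryIntegral

/-- Continuous functions decaying faster than every power. -/
structure RapidDecay {ι : Type} [Fintype ι] (f : EuclideanSpace ℝ ι → ℂ) : Prop where
  continuous : Continuous f
  bound : ∀ N : ℕ, ∃ C : ℝ, ∀ x, (1 + ‖x‖) ^ N * ‖f x‖ ≤ C

/-- Smooth functions with compact support. -/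
structure IsBump {ι : Type} [Fintype ι] (g : EuclideanSpace ℝ ι → ℂ) : Prop where
  contDiff : ContDiff ℝ ∞ g
  hasCompactSupport : HasCompactSupport g

/-- An integrable polynomial weight on `ℝ^ι`. -/
noncomputable def decayWeight {ι : Type} [Fintype ι] (x : EuclideanSpace ℝ ι) : ℝ :=
  ((1 + ‖x‖) ^ (Fintype.card ι + 1))⁻¹

variable {ι κ ν : Type} [Fintype ι] [Fintype κ] [Fintype ν]

lemma integrable_decayWeight : MeasureTheory.Integrable (decayWeight (ι := ι)) := by
  have h := integrable_one_add_norm (E := EuclideanSpace ℝ ι) (μ := MeasureTheory.volume)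
    (r := (Fintype.card ι + 1 : ℕ)) (by simp)
  refine h.congr (Filter.Eventually.of_forall fun x => ?_)
  simp only [decayWeight]
  rw [Real.rpow_neg (by positivity), Real.rpow_natCast]

lemma decayWeight_nonneg (x : EuclideanSpace ℝ ι) : 0 ≤ decayWeight x := by
  unfold decayWeight; positivity

lemma le_mul_decayWeight {x : EuclideanSpace ℝ ι} {r C : ℝ}
    (h : (1 + ‖x‖) ^ (Fintype.card ι + 1) * r ≤ C) : r ≤ C * decayWeight x := by
  have : 0 < (1 + ‖x‖) ^ (Fintype.card ι + 1) := by positivity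
  rw [decayWeight, ← div_eq_mul_inv, le_div_iff₀ this]
  linarith

lemma RapidDecay.exists_le {f : EuclideanSpace ℝ ι → ℂ} (hf : RapidDecay f) :
    ∃ C, 0 ≤ C ∧ ∀ x, ‖f x‖ ≤ C * decayWeight x := by
  obtain ⟨C, hC⟩ := hf.bound (Fintype.card ι + 1)
  exact ⟨C, by simpa using (by positivity : (0 : ℝ) ≤ _).trans (hC 0),
    fun x => le_mul_decayWeight (hC x)⟩

lemma RapidDecay.linear_mul {f : EuclideanSpace ℝ ι → ℂ} (hf : RapidDecay f)
    (ℓ : EuclideanSpace ℝ ι →L[ℝ] ℂ) : RapidDecay fun x => ℓ x * f x := by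
  refine ⟨ℓ.continuous.mul hf.continuous, fun N => ?_⟩
  obtain ⟨C, hC⟩ := hf.bound (N + 1)
  refine ⟨‖ℓ‖ * C, fun x => ?_⟩
  rw [norm_mul]
  have h1 : ‖ℓ x‖ ≤ ‖ℓ‖ * (1 + ‖x‖) := (ℓ.le_opNorm x).trans (by gcongr; linarith)
  calc (1 + ‖x‖) ^ N * (‖ℓ x‖ * ‖f x‖) ≤ (1 + ‖x‖) ^ N * (‖ℓ‖ * (1 + ‖x‖) * ‖f x‖) := by gcongr
    _ = ‖ℓ‖ * ((1 + ‖x‖) ^ (N + 1) * ‖f x‖) := by ring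
    _ ≤ _ := by gcongr; exact hC x

lemma RapidDecay.smul {f : EuclideanSpace ℝ ι → ℂ} (hf : RapidDecay f) (c : ℂ) :
    RapidDecay (c • f) := by
  refine ⟨hf.continuous.const_smul c, fun N => ?_⟩
  obtain ⟨C, hC⟩ := hf.bound N
  refine ⟨‖c‖ * C, fun x => ?_⟩
  rw [Pi.smul_apply, norm_smul, mul_left_comm]
  gcongr
  exact hC x

lemma RapidDecay.add {f f' : EuclideanSpace ℝ ι → ℂ} (hf : RapidDecay f) (hf' : RapidDecay f') :
    RapidDecay (f + f') := by
  refine ⟨hf.continuous.add hf'.continuous, fun N => ?_⟩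
  obtain ⟨C, hC⟩ := hf.bound N
  obtain ⟨C', hC'⟩ := hf'.bound N
  refine ⟨C + C', fun x => ?_⟩
  calc (1 + ‖x‖) ^ N * ‖(f + f') x‖ ≤ (1 + ‖x‖) ^ N * (‖f x‖ + ‖f' x‖) := by
        gcongr; exact norm_add_le _ _
    _ ≤ _ := by rw [mul_add]; exact add_le_add (hC x) (hC' x)

lemma IsBump.exists_le {g : EuclideanSpace ℝ ν → ℂ} (hg : IsBump g) :
    ∃ C, 0 ≤ C ∧ ∀ s, ‖g s‖ ≤ C := by
  obtain ⟨C, hC⟩ := hg.hasCompactSupport.exists_bound_of_continuous hg.contDiff.continuous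
  exact ⟨C, (norm_nonneg _).trans (hC 0), hC⟩

lemma IsBump.fderiv_apply {g : EuclideanSpace ℝ ν → ℂ} (hg : IsBump g)
    (v : EuclideanSpace ℝ ν) : IsBump fun s => fderiv ℝ g s v :=
  ⟨(hg.contDiff.fderiv_right (m := ∞) (by simp)).clm_apply contDiff_const,
    hg.hasCompactSupport.fderiv_apply (𝕜 := ℝ) v⟩

variable (A : EuclideanSpace ℝ ι →L[ℝ] EuclideanSpace ℝ ν)
  (B : EuclideanSpace ℝ κ →L[ℝ] EuclideanSpace ℝ ν)
  (b : EuclideanSpace ℝ ι →L[ℝ] EuclideanSpace ℝ κ →L[ℝ] ℝ)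

/-- The character `e^{2πir}`. -/
noncomputable def unitExp (r : ℝ) : ℂ := Complex.exp (2 * Real.pi * Complex.I * (r : ℂ))

lemma norm_unitExp (r : ℝ) : ‖unitExp r‖ = 1 := by
  rw [unitExp, show (2 * Real.pi * Complex.I * (r : ℂ)) = ((2 * Real.pi * r : ℝ) : ℂ) * Complex.I by
    push_cast; ring]
  exact Complex.norm_exp_ofReal_mul_I _

lemma continuous_unitExp : Continuous unitExp := by
  unfold unitExp; fun_prop

lemma hasDerivAt_unitExp (r : ℝ) :
    HasDerivAt unitExp (2 * Real.pi * Complex.I * unitExp r) r := by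
  have h1 : HasDerivAt (fun r : ℝ => 2 * Real.pi * Complex.I * (r : ℂ))
      (2 * Real.pi * Complex.I * 1) r :=
    (Complex.ofRealCLM.hasDerivAt (x := r)).const_mul _
  exact h1.cexp.congr_deriv (by unfold unitExp; ring)

/-- The integrand of `oscIntegral`. -/
noncomputable def oscIntegrand (f : EuclideanSpace ℝ ι → ℂ) (g : EuclideanSpace ℝ ν → ℂ)
    (z : EuclideanSpace ℝ κ) (x : EuclideanSpace ℝ ι) : ℂ :=
  f x * g (A x + B z) * unitExp (b x z)

/-- The oscillatory integral `∫ f(x) g(Ax + Bz) e^{2πi b(x,z)} dx`. -/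
noncomputable def oscIntegral (f : EuclideanSpace ℝ ι → ℂ) (g : EuclideanSpace ℝ ν → ℂ)
    (z : EuclideanSpace ℝ κ) : ℂ :=
  ∫ x, oscIntegrand A B b f g z x

lemma norm_oscIntegrand (f : EuclideanSpace ℝ ι → ℂ) (g : EuclideanSpace ℝ ν → ℂ)
    (z : EuclideanSpace ℝ κ) (x : EuclideanSpace ℝ ι) :
    ‖oscIntegrand A B b f g z x‖ = ‖f x‖ * ‖g (A x + B z)‖ := by
  rw [oscIntegrand, norm_mul, norm_unitExp, mul_one, norm_mul]

lemma continuous_oscIntegrand {f : EuclideanSpace ℝ ι → ℂ} {g : EuclideanSpace ℝ ν → ℂ}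
    (hf : Continuous f) (hg : Continuous g) (z : EuclideanSpace ℝ κ) :
    Continuous (oscIntegrand A B b f g z) := by
  have h1 : Continuous fun x => b x z := (b.flip z).continuous
  exact (hf.mul (hg.comp (A.continuous.add continuous_const))).mul (continuous_unitExp.comp h1)

lemma integrable_oscIntegrand {f : EuclideanSpace ℝ ι → ℂ} {g : EuclideanSpace ℝ ν → ℂ}
    (hf : RapidDecay f) (hg : IsBump g) (z : EuclideanSpace ℝ κ) :
    MeasureTheory.Integrable (oscIntegrand A B b f g z) := by
  obtain ⟨C, hC, hfC⟩ := hf.exists_le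
  obtain ⟨D, hD, hgD⟩ := hg.exists_le
  refine MeasureTheory.Integrable.mono' (integrable_decayWeight.const_mul (C * D))
    (continuous_oscIntegrand A B b hf.continuous hg.contDiff.continuous z).aestronglyMeasurable
    (Filter.Eventually.of_forall fun x => ?_)
  rw [norm_oscIntegrand]
  calc ‖f x‖ * ‖g (A x + B z)‖ ≤ C * decayWeight x * D := by
        gcongr
        · exact mul_nonneg hC (decayWeight_nonneg x)
        · exact hfC x
        · exact hgD _
    _ = _ := by ring

lemma mul_norm_oscIntegral_le {f : EuclideanSpace ℝ ι → ℂ} {g : EuclideanSpace ℝ ν → ℂ}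
    {r K : ℝ} (hr : 0 ≤ r) {z : EuclideanSpace ℝ κ}
    (h : ∀ x, r * (‖f x‖ * ‖g (A x + B z)‖) ≤ K * decayWeight x) :
    r * ‖oscIntegral A B b f g z‖ ≤ K * ∫ x : EuclideanSpace ℝ ι, decayWeight x := by
  have e : r * ‖oscIntegral A B b f g z‖ = ‖∫ x, (r : ℂ) * oscIntegrand A B b f g z x‖ := by
    rw [MeasureTheory.integral_const_mul, norm_mul, Complex.norm_real, Real.norm_of_nonneg hr]
    rfl
  rw [e, ← MeasureTheory.integral_const_mul]
  refine MeasureTheory.norm_integral_le_of_norm_le (integrable_decayWeight.const_mul K)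
    (Filter.Eventually.of_forall fun x => ?_)
  rw [norm_mul, Complex.norm_real, Real.norm_of_nonneg hr, norm_oscIntegrand]
  exact h x

lemma oscIntegral_zero_left (g : EuclideanSpace ℝ ν → ℂ) :
    oscIntegral A B b 0 g = 0 := by
  funext z; simp [oscIntegral, oscIntegrand]

lemma oscIntegral_zero_right (f : EuclideanSpace ℝ ι → ℂ) :
    oscIntegral A B b f 0 = 0 := by
  funext z; simp [oscIntegral, oscIntegrand]

lemma oscIntegral_add_left {f f' : EuclideanSpace ℝ ι → ℂ} {g : EuclideanSpace ℝ ν → ℂ}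
    (hf : RapidDecay f) (hf' : RapidDecay f') (hg : IsBump g) :
    oscIntegral A B b (f + f') g = oscIntegral A B b f g + oscIntegral A B b f' g := by
  funext z
  rw [Pi.add_apply, oscIntegral, oscIntegral, oscIntegral, ← MeasureTheory.integral_add
    (integrable_oscIntegrand A B b hf hg z) (integrable_oscIntegrand A B b hf' hg z)]
  congr 1
  funext x
  simp only [oscIntegrand, Pi.add_apply]
  ring

lemma oscIntegral_smul_left (c : ℂ) (f : EuclideanSpace ℝ ι → ℂ) (g : EuclideanSpace ℝ ν → ℂ) :
    oscIntegral A B b (c • f) g = c • oscIntegral A B b f g := by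
  funext z
  rw [Pi.smul_apply, oscIntegral, oscIntegral, smul_eq_mul, ← MeasureTheory.integral_const_mul]
  congr 1
  funext x
  simp only [oscIntegrand, Pi.smul_apply, smul_eq_mul]
  ring

lemma oscIntegral_sum_right [DecidableEq ν] {f : EuclideanSpace ℝ ι → ℂ}
    {g : EuclideanSpace ℝ ν → ℂ} (hf : RapidDecay f) (hg : IsBump g) (v : EuclideanSpace ℝ ν) :
    oscIntegral A B b f (fun s => fderiv ℝ g s v) =
      ∑ i, (v i : ℂ) • oscIntegral A B b f (pderiv i g) := by
  funext z
  have hint : ∀ i ∈ Finset.univ, MeasureTheory.Integrable fun x =>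
      (v i : ℂ) • oscIntegrand A B b f (pderiv i g) z x := fun i _ =>
    (integrable_oscIntegrand A B b hf
      (hg.fderiv_apply (EuclideanSpace.single i 1)) z).smul (v i : ℂ)
  simp only [Finset.sum_apply, Pi.smul_apply, oscIntegral]
  simp only [← MeasureTheory.integral_smul]
  rw [← MeasureTheory.integral_finsetSum _ hint]
  congr 1
  funext x
  have hv : v = ∑ i, v i • EuclideanSpace.single i (1 : ℝ) := by
    simpa using ((EuclideanSpace.basisFun ν ℝ).sum_repr v).symm
  have : fderiv ℝ g (A x + B z) v = ∑ i, (v i : ℂ) * pderiv i g (A x + B z) := by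
    conv_lhs => rw [hv]
    rw [map_sum]
    simp [pderiv]
  simp only [oscIntegrand, this, smul_eq_mul, Finset.mul_sum, Finset.sum_mul]
  refine Finset.sum_congr rfl fun i _ => ?_
  ring

/-- Differentiation under the integral sign. Both resulting terms are again oscillatory integrals
with an admissible amplitude and window, which lets the argument be iterated. -/
lemma hasFDerivAt_oscIntegral {f : EuclideanSpace ℝ ι → ℂ} {g : EuclideanSpace ℝ ν → ℂ}
    (hf : RapidDecay f) (hg : IsBump g) (z : EuclideanSpace ℝ κ) :
    DifferentiableAt ℝ (oscIntegral A B b f g) z ∧ ∀ v,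
      fderiv ℝ (oscIntegral A B b f g) z v =
        oscIntegral A B b f (fun s => fderiv ℝ g s (B v)) z +
        oscIntegral A B b (fun x => (2 * Real.pi * Complex.I * (b x v : ℝ)) * f x) g z := by
  have hdg : ∀ s, HasFDerivAt g (fderiv ℝ g s) s := fun s =>
    (hg.contDiff.differentiable (by simp) s).hasFDerivAt
  set F' : EuclideanSpace ℝ κ → EuclideanSpace ℝ ι → EuclideanSpace ℝ κ →L[ℝ] ℂ := fun z x =>
    (f x * unitExp (b x z)) • (fderiv ℝ g (A x + B z)).comp B +
      (f x * g (A x + B z) * (2 * Real.pi * Complex.I * unitExp (b x z))) •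
        (Complex.ofRealCLM.comp (b x)) with hF'
  have hder : ∀ x z, HasFDerivAt (fun z => oscIntegrand A B b f g z x) (F' z x) z := by
    intro x z
    have h1 : HasFDerivAt (fun z => A x + B z) B z := B.hasFDerivAt.const_add _
    have h2 : HasFDerivAt (fun z => unitExp (b x z)) _ z :=
      (hasDerivAt_unitExp (b x z)).hasFDerivAt.comp z (b x).hasFDerivAt
    have h3 := (((hdg _).comp z h1).const_mul (f x)).mul h2
    refine h3.congr_fderiv ?_
    ext v
    simp [hF']
    ring
  -- Differentiating the character produces a factor of size ‖b‖‖x‖; bounding (1 + ‖x‖) f instead of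
  -- f leaves an integrable majorant uniform in z.
  obtain ⟨C, hC, hfC⟩ := (RapidDecay.mk (f := fun x => ((1 + ‖x‖ : ℝ) : ℂ) * f x)
    (by have := hf.continuous; fun_prop) (fun N => by
      obtain ⟨C, hC⟩ := hf.bound (N + 1)
      refine ⟨C, fun x => (le_of_eq ?_).trans (hC x)⟩
      rw [norm_mul, Complex.norm_real, Real.norm_of_nonneg (by positivity)]
      ring)).exists_le
  obtain ⟨D, hD, hgD⟩ := hg.exists_le
  obtain ⟨D', hD'⟩ := (hg.hasCompactSupport.fderiv (𝕜 := ℝ)).exists_bound_of_continuous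
    (hg.contDiff.continuous_fderiv (by simp))
  have hD'0 : 0 ≤ D' := (norm_nonneg _).trans (hD' 0)
  have hbound : ∀ x z, ‖F' z x‖ ≤ C * (D' * ‖B‖ + D * (2 * Real.pi) * ‖b‖) * decayWeight x := by
    intro x z
    have e1 : ‖(fderiv ℝ g (A x + B z)).comp B‖ ≤ D' * ‖B‖ :=
      (ContinuousLinearMap.opNorm_comp_le _ _).trans (by gcongr; exact hD' _)
    have e2 : ‖Complex.ofRealCLM.comp (b x)‖ ≤ ‖b‖ * ‖x‖ := by
      refine (ContinuousLinearMap.opNorm_comp_le _ _).trans ?_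
      rw [Complex.ofRealCLM_norm, one_mul]
      exact b.le_opNorm x
    have e3 : (1 + ‖x‖) * ‖f x‖ ≤ C * decayWeight x := by
      have := hfC x
      rwa [norm_mul, Complex.norm_real, Real.norm_of_nonneg (by positivity)] at this
    have e4 : ‖(2 * Real.pi * Complex.I : ℂ)‖ = 2 * Real.pi := by
      simp [abs_of_pos Real.pi_pos]
    calc ‖F' z x‖ ≤ ‖f x‖ * (D' * ‖B‖) + ‖f x‖ * D * (2 * Real.pi) * (‖b‖ * ‖x‖) := by
          refine (norm_add_le _ _).trans (add_le_add ?_ ?_)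
          · rw [norm_smul, norm_mul, norm_unitExp, mul_one]
            gcongr
          · rw [norm_smul, norm_mul, norm_mul, norm_mul _ (unitExp _), norm_unitExp, mul_one, e4]
            gcongr
            exact hgD _
      _ ≤ (1 + ‖x‖) * ‖f x‖ * (D' * ‖B‖ + D * (2 * Real.pi) * ‖b‖) := by
          have p1 : 0 ≤ ‖x‖ * (‖f x‖ * (D' * ‖B‖)) := by positivity
          have p2 : 0 ≤ ‖f x‖ * (D * (2 * Real.pi) * ‖b‖) := by positivity
          nlinarith
      _ ≤ C * decayWeight x * (D' * ‖B‖ + D * (2 * Real.pi) * ‖b‖) := by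
          gcongr
      _ = _ := by ring
  have hcont : Continuous (F' z) := by
    have c1 : Continuous fun x => b x z := (b.flip z).continuous
    have c2 : Continuous fun x => A x + B z := A.continuous.add continuous_const
    have c3 := continuous_unitExp.comp c1
    have c4 : Continuous fun x => (fderiv ℝ g (A x + B z)) :=
      (hg.contDiff.continuous_fderiv (by simp)).comp c2
    have c5 := hg.contDiff.continuous.comp c2
    have c6 : Continuous fun x => (fderiv ℝ g (A x + B z)).comp B := c4.clm_comp continuous_const
    have c7 : Continuous fun x => Complex.ofRealCLM.comp (b x) :=
      continuous_const.clm_comp b.continuous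
    exact ((hf.continuous.mul c3).smul c6).add
      (((hf.continuous.mul c5).mul (continuous_const.mul c3)).smul c7)
  have hbi := integrable_decayWeight (ι := ι).const_mul
    (C * (D' * ‖B‖ + D * (2 * Real.pi) * ‖b‖))
  have hmain : HasFDerivAt (oscIntegral A B b f g) (∫ x, F' z x) z :=
    hasFDerivAt_integral_of_dominated_of_fderiv_le (s := Set.univ) Filter.univ_mem
      (Filter.Eventually.of_forall fun z =>
        (integrable_oscIntegrand A B b hf hg z).aestronglyMeasurable)
      (integrable_oscIntegrand A B b hf hg z) hcont.aestronglyMeasurable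
      (Filter.Eventually.of_forall fun x z _ => hbound x z) hbi
      (Filter.Eventually.of_forall fun x z _ => hder x z)
  refine ⟨hmain.differentiableAt, fun v => ?_⟩
  have hF'int : MeasureTheory.Integrable (F' z) :=
    hbi.mono' hcont.aestronglyMeasurable (Filter.Eventually.of_forall fun x => hbound x z)
  have hℓ : RapidDecay fun x => (2 * Real.pi * Complex.I * (b x v : ℝ)) * f x :=
    hf.linear_mul ((2 * Real.pi * Complex.I : ℂ) • (Complex.ofRealCLM.comp (b.flip v)))
  rw [hmain.fderiv, ContinuousLinearMap.integral_apply hF'int, oscIntegral, oscIntegral,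
    ← MeasureTheory.integral_add
      (integrable_oscIntegrand A B b hf (hg.fderiv_apply _) z)
      (integrable_oscIntegrand A B b hℓ hg z)]
  congr 1
  funext x
  simp [hF', oscIntegrand]
  ring

lemma oscIntegral_contDiff {f : EuclideanSpace ℝ ι → ℂ} {g : EuclideanSpace ℝ ν → ℂ}
    (hf : RapidDecay f) (hg : IsBump g) : ContDiff ℝ ∞ (oscIntegral A B b f g) := by
  refine contDiff_infty.2 fun m => ?_
  induction m generalizing f g with
  | zero =>
    exact contDiff_zero.2 (continuous_iff_continuousAt.2 fun z =>
      (hasFDerivAt_oscIntegral A B b hf hg z).1.continuousAt)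
  | succ m ih =>
    have h := hasFDerivAt_oscIntegral A B b hf hg
    push_cast
    refine contDiff_succ_iff_fderiv.2 ⟨fun z => (h z).1, by simp, contDiff_clm_apply_iff.2 fun v => ?_⟩
    have hℓ : RapidDecay fun x => (2 * Real.pi * Complex.I * (b x v : ℝ)) * f x :=
      hf.linear_mul ((2 * Real.pi * Complex.I : ℂ) • (Complex.ofRealCLM.comp (b.flip v)))
    simp only [fun z => (h z).2 v]
    exact (ih hf (hg.fderiv_apply _)).add (ih hℓ hg)

/-- Differentiating the character in x along v yields the factor 2πi b(v, z); the derivative is then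
moved to the amplitude f and to the window, which contributes the direction A v. -/
lemma oscIntegral_by_parts {f : EuclideanSpace ℝ ι → ℂ} {g : EuclideanSpace ℝ ν → ℂ}
    (hf : RapidDecay f) (hg : IsBump g) (v : EuclideanSpace ℝ ι) (hd : Differentiable ℝ f)
    (hf' : RapidDecay fun x => fderiv ℝ f x v) (z : EuclideanSpace ℝ κ) :
    (2 * Real.pi * Complex.I * (b v z : ℝ)) * oscIntegral A B b f g z =
      -(oscIntegral A B b (fun x => fderiv ℝ f x v) g z +
        oscIntegral A B b f (fun s => fderiv ℝ g s (A v)) z) := by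
  have hG : ∀ x, HasFDerivAt (fun x => g (A x + B z) * unitExp (b x z))
      (unitExp (b x z) • (fderiv ℝ g (A x + B z)).comp A +
        (g (A x + B z) * (2 * Real.pi * Complex.I * unitExp (b x z))) •
          (Complex.ofRealCLM.comp (b.flip z))) x := by
    intro x
    have h1 : HasFDerivAt (fun x => A x + B z) A x := A.hasFDerivAt.add_const _
    have h0 : HasFDerivAt (fun x => b x z) (b.flip z) x := (b.flip z).hasFDerivAt
    have h2 := (hasDerivAt_unitExp (b x z)).hasFDerivAt.comp x h0
    have h3 := ((hg.contDiff.differentiable (by simp) _).hasFDerivAt.comp x h1).mul h2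
    refine h3.congr_fderiv ?_
    ext w
    simp
    ring
  have i1 := integrable_oscIntegrand A B b hf hg z
  have i2 := integrable_oscIntegrand A B b hf' hg z
  have i3 := integrable_oscIntegrand A B b hf (hg.fderiv_apply (A v)) z
  have e : (fun x => f x * fderiv ℝ (fun x => g (A x + B z) * unitExp (b x z)) x v) =
      fun x => oscIntegrand A B b f (fun s => fderiv ℝ g s (A v)) z x +
        (2 * Real.pi * Complex.I * (b v z : ℝ)) * oscIntegrand A B b f g z x := by
    funext x
    rw [(hG x).fderiv]
    simp [oscIntegrand]
    ring
  have e' : (fun x => fderiv ℝ f x v * (g (A x + B z) * unitExp (b x z))) =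
      oscIntegrand A B b (fun x => fderiv ℝ f x v) g z := by
    funext x; simp [oscIntegrand]; ring
  have e'' : (fun x => f x * (g (A x + B z) * unitExp (b x z))) =
      oscIntegrand A B b f g z := by
    funext x; simp [oscIntegrand]; ring
  have key := integral_mul_fderiv_eq_neg_fderiv_mul_of_integrable (μ := MeasureTheory.volume)
    (f := f) (g := fun x => g (A x + B z) * unitExp (b x z)) (v := v)
    (by rw [e']; exact i2) (by rw [e]; exact i3.add (i1.const_mul _)) (by rw [e'']; exact i1)
    (fun x _ => hd x) (fun x _ => (hG x).differentiableAt)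
  rw [e, e', MeasureTheory.integral_add i3 (i1.const_mul _),
    MeasureTheory.integral_const_mul] at key
  simp only [oscIntegral]
  linear_combination key

end OscillatoryIntegral

/-! ### Iterating the recurrences over words. -/

section Words

variable {ι : Type} [Fintype ι] [DecidableEq ι]

lemma sum_map_eq_of_count {v : List ι} {p : ι → ℕ} (h : ∀ i, v.count i = p i) (f : ι → ℕ) :
    (v.map f).sum = ∑ i, p i * f i := by
  rw [Finset.sum_list_map_count]
  simp only [h, smul_eq_mul]
  refine Finset.sum_subset (Finset.subset_univ _) fun i _ hi => ?_
  rw [← h, List.count_eq_zero_of_not_mem (by simpa using hi), zero_mul]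

lemma length_eq_of_count {v : List ι} {p : ι → ℕ} (h : ∀ i, v.count i = p i) :
    v.length = ∑ i, p i := by
  simpa using sum_map_eq_of_count h fun _ => 1

lemma prod_map_eq_of_count {v : List ι} {p : ι → ℕ} (h : ∀ i, v.count i = p i) (f : ι → ℝ) :
    (v.map f).prod = ∏ i, f i ^ p i := by
  rw [Finset.prod_list_map_count]
  simp only [h]
  refine Finset.prod_subset (Finset.subset_univ _) fun i _ hi => ?_
  rw [← h, List.count_eq_zero_of_not_mem (by simpa using hi), pow_zero]

lemma exists_list_count (p : ι → ℕ) : ∃ v : List ι, ∀ i, v.count i = p i :=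
  let ⟨w, hw, _⟩ := exists_multiDeriv_eq_wordDeriv p
  ⟨w, hw⟩

/-- Bounds for repeated multiplication by coordinates, in a family indexed by states on which
a multiplication acts by finitely many transitions. -/
lemma list_prod_mul_le_mixedWeight {S I J : Type} [Fintype I] {θ₁ θ₂ : ℝ} (h₁ : 0 ≤ θ₁)
    (h₂ : 0 ≤ θ₂) (h : 1 ≤ θ₁ + θ₂) (N : S → ℝ) (M s : S → ℕ) (ζ : J → ℝ) (hζ : ∀ j, 0 ≤ ζ j)
    {K H : ℝ} (hK : 0 ≤ K) (hH : 1 ≤ H)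
    (hbase : ∀ σ, N σ ≤ K * H ^ (M σ + s σ) * mixedWeight θ₁ θ₂ (M σ) (s σ))
    (hrel : ∀ σ j, ∃ (c : ℕ) (τ₀ : S) (τ : I → S), ζ j * N σ ≤ c * N τ₀ + ∑ i, N (τ i) ∧
      (c = 0 ∨ (M τ₀ + 1 = M σ ∧ c ≤ M σ ∧ s τ₀ = s σ)) ∧
      ∀ i, M (τ i) = M σ ∧ s (τ i) = s σ + 1)
    (v : List J) (σ : S) :
    (v.map ζ).prod * N σ ≤ K * (Fintype.card I + 1) ^ v.length *
      H ^ (v.length + (M σ + s σ)) * mixedWeight θ₁ θ₂ (M σ) (v.length + s σ) := by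
  induction v generalizing σ with
  | nil => simpa using hbase σ
  | cons j v ih =>
    obtain ⟨c, τ₀, τ, hle, h0, hτ⟩ := hrel σ j
    have hprod : 0 ≤ (v.map ζ).prod := List.prod_nonneg (by simpa using fun j _ => hζ j)
    set l := v.length with hl
    set W := K * (Fintype.card I + 1) ^ l * H ^ (l + 1 + (M σ + s σ)) *
      mixedWeight θ₁ θ₂ (M σ) (l + 1 + s σ) with hW
    have hmw := mixedWeight_nonneg θ₁ θ₂
    have hH0 : 0 ≤ H := by linarith
    have hW0 : 0 ≤ W := by
      have := hmw (M σ) (l + 1 + s σ)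
      positivity
    -- The term in which the derivative hits the monomial: its coefficient is at most M, and M times
    -- the weight at M - 1 is absorbed by the weight at M with one more letter.
    have t0 : c * ((v.map ζ).prod * N τ₀) ≤ W := by
      rcases h0 with rfl | ⟨hM, hc, hs⟩
      · simpa using hW0
      · have hw := succ_mul_mixedWeight_le h₁ h₂ h (M τ₀) (l + s τ₀)
        have hwn := hmw (M τ₀) (l + s τ₀)
        rw [hM, hs, show l + s σ + 1 = l + 1 + s σ by ring] at hw
        rw [hs] at hwn
        have ih0 := ih τ₀
        rw [hs] at ih0
        calc c * ((v.map ζ).prod * N τ₀) ≤ (M σ : ℝ) * (K * (Fintype.card I + 1) ^ l *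
              H ^ (l + 1 + (M σ + s σ)) * mixedWeight θ₁ θ₂ (M τ₀) (l + s σ)) := by
              refine (mul_le_mul_of_nonneg_left ih0 (Nat.cast_nonneg c)).trans ?_
              gcongr
              · omega
              · omega
          _ = K * (Fintype.card I + 1) ^ l * H ^ (l + 1 + (M σ + s σ)) *
              ((M σ : ℝ) * mixedWeight θ₁ θ₂ (M τ₀) (l + s σ)) := by ring
          _ ≤ W := by rw [hW]; gcongr
    -- The other transitions raise s by one while the word is one letter shorter, so the arguments
    -- of the weight are already the right ones.
    have t1 : ∀ i, (v.map ζ).prod * N (τ i) ≤ W := by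
      intro i
      have := ih (τ i)
      rw [(hτ i).1, (hτ i).2] at this
      refine this.trans (le_of_eq ?_)
      rw [hW, show l + (M σ + (s σ + 1)) = l + 1 + (M σ + s σ) by ring,
        show l + (s σ + 1) = l + 1 + s σ by ring]
    have hsum : ∑ i, (v.map ζ).prod * N (τ i) ≤ Fintype.card I * W := by
      simpa using Finset.sum_le_card_nsmul Finset.univ _ W fun i _ => t1 i
    simp only [List.map_cons, List.prod_cons, List.length_cons, ← hl]
    calc ζ j * (v.map ζ).prod * N σ = (v.map ζ).prod * (ζ j * N σ) := by ring
      _ ≤ (v.map ζ).prod * (c * N τ₀ + ∑ i, N (τ i)) := by gcongr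
      _ = c * ((v.map ζ).prod * N τ₀) + ∑ i, (v.map ζ).prod * N (τ i) := by
        rw [mul_add, Finset.mul_sum]; ring
      _ ≤ W + Fintype.card I * W := add_le_add t0 hsum
      _ = _ := by rw [hW, pow_succ]; ring

/-- Bounds for repeated differentiation, in a family of functions indexed by states on which
a derivative acts by finitely many transitions. -/
lemma norm_wordDeriv_le {S I : Type} [Fintype I] (Θ : S → EuclideanSpace ℝ ι → ℂ)
    (hΘ : ∀ σ, ContDiff ℝ ∞ (Θ σ)) (M s : S → ℕ) (dM ds : ι → ℕ) {D : ℝ} (hD : 0 ≤ D)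
    (hrel : ∀ σ l, ∃ (c : I → ℂ) (τ : I → S), pderiv l (Θ σ) = ∑ i, c i • Θ (τ i) ∧
      ∀ i, ‖c i‖ ≤ D ∧ M (τ i) = M σ + dM l ∧ s (τ i) = s σ + ds l)
    {z : EuclideanSpace ℝ ι} {r : ℝ} (hr : 0 ≤ r) (E : ℕ → ℕ → ℝ)
    (hE : ∀ σ, r * ‖Θ σ z‖ ≤ E (M σ) (s σ)) (w : List ι) (σ : S) :
    r * ‖wordDeriv w (Θ σ) z‖ ≤ (D * Fintype.card I) ^ w.length *
      E (M σ + (w.map dM).sum) (s σ + (w.map ds).sum) := by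
  induction w generalizing σ with
  | nil => simpa [wordDeriv] using hE σ
  | cons l w ih =>
    obtain ⟨c, τ, hd, hτ⟩ := hrel σ l
    set W := (D * Fintype.card I) ^ w.length *
      E (M σ + ((l :: w).map dM).sum) (s σ + ((l :: w).map ds).sum) with hW
    have t : ∀ i, ‖c i‖ * (r * ‖wordDeriv w (Θ (τ i)) z‖) ≤ D * W := by
      intro i
      have h1 := ih (τ i)
      rw [(hτ i).2.1, (hτ i).2.2, add_assoc, add_assoc] at h1
      rw [hW, List.map_cons, List.map_cons, List.sum_cons, List.sum_cons]
      exact mul_le_mul (hτ i).1 h1 (by positivity) hD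
    have hs : ∀ i, ContDiff ℝ ∞ (c i • Θ (τ i)) := fun i => (hΘ _).const_smul (c i)
    rw [wordDeriv, hd, wordDeriv_sum _ _ hs, Finset.sum_apply]
    simp only [wordDeriv_smul _ _ (hΘ _), Pi.smul_apply]
    calc r * ‖∑ i, c i • wordDeriv w (Θ (τ i)) z‖
        ≤ r * ∑ i, ‖c i • wordDeriv w (Θ (τ i)) z‖ := by gcongr; exact norm_sum_le _ _
      _ = ∑ i, ‖c i‖ * (r * ‖wordDeriv w (Θ (τ i)) z‖) := by
          rw [Finset.mul_sum]
          refine Finset.sum_congr rfl fun i _ => ?_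
          rw [norm_smul]; ring
      _ ≤ Fintype.card I * (D * W) := by
          simpa using Finset.sum_le_card_nsmul Finset.univ _ (D * W) fun i _ => t i
      _ = _ := by rw [hW, List.length_cons, pow_succ]; ring

end Words

/-! ### Rapid decay and compact support from finite norms. -/

section Decay

variable {ι : Type} [Fintype ι] [DecidableEq ι] {α β : ι → ℝ} {a : ℝ}
  {φ : EuclideanSpace ℝ ι → ℂ}

lemma rapidDecay_monoDeriv (hsm : ContDiff ℝ ∞ φ) (ha : 0 < a) (hφ : gsNorm α β a φ < ⊤)
    (p q : ι → ℕ) : RapidDecay (monoDeriv p q φ) := by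
  refine ⟨(monoDeriv_contDiff p q hsm).continuous, fun N => ?_⟩
  have ha' : 0 < min a 1 := lt_min ha one_pos
  exact ⟨_, one_add_norm_pow_mul_monoDeriv_le ha' (min_le_right _ _)
    ((gsNorm_mono α β ha'.le (min_le_left _ _) φ).trans_lt hφ) N p q⟩

lemma isBump_multiDeriv {g : EuclideanSpace ℝ ι → ℂ} (hsm : ContDiff ℝ ∞ g) (ha : 0 < a)
    (hg : gsNorm α (fun _ => 0) a g < ⊤) (q : ι → ℕ) : IsBump (multiDeriv q g) :=
  ⟨multiDeriv_contDiff q hsm, hasCompactSupport_multiDeriv_of_decay_zero ha hg q⟩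

end Decay

/-! ### The two recurrences, for derivatives and for multiplication by linear forms. -/

section Operators

variable {ι κ ν : Type} [Fintype ι] [Fintype κ] [Fintype ν]
  (A : EuclideanSpace ℝ ι →L[ℝ] EuclideanSpace ℝ ν)
  (B : EuclideanSpace ℝ κ →L[ℝ] EuclideanSpace ℝ ν)
  (b : EuclideanSpace ℝ ι →L[ℝ] EuclideanSpace ℝ κ →L[ℝ] ℝ)

lemma pderiv_oscIntegral [DecidableEq κ] [DecidableEq ν] {f : EuclideanSpace ℝ ι → ℂ}
    {g : EuclideanSpace ℝ ν → ℂ} (hf : RapidDecay f) (hg : IsBump g) (l : κ) :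
    pderiv l (oscIntegral A B b f g) =
      ∑ i, (B (EuclideanSpace.single l 1) i : ℂ) • oscIntegral A B b f (pderiv i g) +
      (2 * Real.pi * Complex.I : ℂ) •
        oscIntegral A B b (fun x => (b x (EuclideanSpace.single l 1) : ℝ) * f x) g := by
  rw [← oscIntegral_sum_right A B b hf hg, ← oscIntegral_smul_left]
  funext z
  have := (hasFDerivAt_oscIntegral A B b hf hg z).2 (EuclideanSpace.single l 1)
  rw [pderiv, this, Pi.add_apply]
  congr 3
  funext x
  simp [mul_assoc]

/-- Integration by parts along a coordinate, with the Leibniz rule for t^a φ^(q). The three kinds of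
terms are those of the later recurrence: lower a at the cost a_j, raise q, or differentiate the
window. -/
lemma coord_mul_oscIntegral [DecidableEq ι] [DecidableEq ν] {α β : ι → ℝ} {a₀ : ℝ}
    {φ : EuclideanSpace ℝ ι → ℂ} (hsm : ContDiff ℝ ∞ φ) (ha₀ : 0 < a₀)
    (hφ : gsNorm α β a₀ φ < ⊤) {g : EuclideanSpace ℝ ν → ℂ} (hg : IsBump g) (a q : ι → ℕ)
    (j : ι) (z : EuclideanSpace ℝ κ) :
    (2 * Real.pi * Complex.I * (b (EuclideanSpace.single j 1) z : ℝ)) *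
        oscIntegral A B b (monoDeriv a q φ) g z =
      -((a j : ℂ) * oscIntegral A B b (monoDeriv (a - Pi.single j 1) q φ) g z +
        oscIntegral A B b (monoDeriv a (q + Pi.single j 1) φ) g z +
        ∑ i, (A (EuclideanSpace.single j 1) i : ℂ) *
          oscIntegral A B b (monoDeriv a q φ) (pderiv i g) z) := by
  have hf := rapidDecay_monoDeriv hsm ha₀ hφ
  have hd : (fun x => fderiv ℝ (monoDeriv a q φ) x (EuclideanSpace.single j 1)) =
      (a j : ℂ) • monoDeriv (a - Pi.single j 1) q φ + monoDeriv a (q + Pi.single j 1) φ :=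
    pderiv_monoDeriv a q hsm j
  rw [oscIntegral_by_parts A B b (hf a q) hg _
    ((monoDeriv_contDiff a q hsm).differentiable (by simp))
    (by rw [hd]; exact ((hf _ _).smul _).add (hf _ _)), hd,
    oscIntegral_sum_right A B b (hf a q) hg,
    oscIntegral_add_left A B b ((hf _ _).smul _) (hf _ _) hg, oscIntegral_smul_left]
  simp

end Operators

/-! ### The linear data that specialise the oscillatory integral to the two operators. -/

section PhaseSpace

variable {k n : ℕ}

/-- `dirs` as a continuous linear map. -/
noncomputable def dirsL (u : Fin k → EuclideanSpace ℝ (Fin n)) :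
    EuclideanSpace ℝ (Fin n) →L[ℝ] EuclideanSpace ℝ (Fin k) :=
  ∑ i, (innerSL ℝ (u i)).smulRight (EuclideanSpace.single i (1 : ℝ))

lemma dirsL_apply (u : Fin k → EuclideanSpace ℝ (Fin n)) (t : EuclideanSpace ℝ (Fin n))
    (i : Fin k) : dirsL u t i = inner ℝ (u i) t := by
  simp [dirsL, Pi.single_apply]

lemma dirsL_eq_dirs (u : Fin k → EuclideanSpace ℝ (Fin n)) (t : EuclideanSpace ℝ (Fin n)) :
    dirsL u t = dirs u t := by
  ext i
  rw [dirsL_apply]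
  rfl

/-- The map `(y, ξ) ↦ -y`. -/
noncomputable def negFst (k n : ℕ) :
    EuclideanSpace ℝ (Fin k ⊕ Fin n) →L[ℝ] EuclideanSpace ℝ (Fin k) :=
  ∑ i, (EuclideanSpace.proj (Sum.inl i) : EuclideanSpace ℝ (Fin k ⊕ Fin n) →L[ℝ] ℝ).smulRight
    (-EuclideanSpace.single i (1 : ℝ))

lemma negFst_apply (z : EuclideanSpace ℝ (Fin k ⊕ Fin n)) (i : Fin k) :
    negFst k n z i = -z (Sum.inl i) := by
  simp [negFst, Pi.single_apply]

/-- The pairing `(t, (y, ξ)) ↦ t · ξ`. -/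
noncomputable def freqPairing (k n : ℕ) :
    EuclideanSpace ℝ (Fin n) →L[ℝ] EuclideanSpace ℝ (Fin k ⊕ Fin n) →L[ℝ] ℝ :=
  ∑ j, (EuclideanSpace.proj j : EuclideanSpace ℝ (Fin n) →L[ℝ] ℝ).smulRight
    (EuclideanSpace.proj (Sum.inr j) : EuclideanSpace ℝ (Fin k ⊕ Fin n) →L[ℝ] ℝ)

lemma freqPairing_apply (t : EuclideanSpace ℝ (Fin n)) (z : EuclideanSpace ℝ (Fin k ⊕ Fin n)) :
    freqPairing k n t z = ∑ j, t j * z (Sum.inr j) := by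
  simp [freqPairing]

lemma freqPairing_single_left (j : Fin n) (z : EuclideanSpace ℝ (Fin k ⊕ Fin n)) :
    freqPairing k n (EuclideanSpace.single j 1) z = z (Sum.inr j) := by
  simp [freqPairing_apply]

lemma freqPairing_single_inr (t : EuclideanSpace ℝ (Fin n)) (j : Fin n) :
    freqPairing k n t (EuclideanSpace.single (Sum.inr j) 1) = t j := by
  simp [freqPairing_apply]

lemma freqPairing_single_inl (t : EuclideanSpace ℝ (Fin n)) (i : Fin k) :
    freqPairing k n t (EuclideanSpace.single (Sum.inl i) 1) = 0 := by
  simp [freqPairing_apply]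

lemma abs_dirsL_le {u : Fin k → EuclideanSpace ℝ (Fin n)} (hu : ∀ i, ‖u i‖ = 1)
    (t : EuclideanSpace ℝ (Fin n)) (i : Fin k) : |dirsL u t i| ≤ ‖t‖ := by
  rw [dirsL_apply]
  simpa [hu i] using abs_real_inner_le_norm (u i) t

/-- The directional short-time Fourier transform, with window `ḡ`, as an oscillatory integral. -/
noncomputable def analysis (u : Fin k → EuclideanSpace ℝ (Fin n))
    (f : EuclideanSpace ℝ (Fin n) → ℂ) (g : EuclideanSpace ℝ (Fin k) → ℂ) :
    EuclideanSpace ℝ (Fin k ⊕ Fin n) → ℂ :=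
  oscIntegral (dirsL u) (negFst k n) (-freqPairing k n) f g

/-- The directional synthesis operator as an oscillatory integral. -/
noncomputable def synthesis (u : Fin k → EuclideanSpace ℝ (Fin n))
    (F : EuclideanSpace ℝ (Fin k ⊕ Fin n) → ℂ) (g : EuclideanSpace ℝ (Fin k) → ℂ) :
    EuclideanSpace ℝ (Fin n) → ℂ :=
  oscIntegral (negFst k n) (dirsL u) (freqPairing k n).flip F g

end PhaseSpace

/-! ### Weight comparisons with one base X and one exponent N. -/

section Numeric

lemma one_le_factorial_rpow {γ : ℝ} (hγ : 0 ≤ γ) (m : ℕ) : 1 ≤ (m.factorial : ℝ) ^ γ :=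
  Real.one_le_rpow (by exact_mod_cast Nat.factorial_pos m) hγ

lemma two_pow_rpow_le {γ δ : ℝ} (hγ : 0 ≤ γ) (hδ : γ ≤ δ) {m N : ℕ} (h : m ≤ N) :
    ((2 : ℝ) ^ m) ^ γ ≤ ((2 : ℝ) ^ N) ^ δ := by
  have h1 : (2 : ℝ) ^ m ≤ 2 ^ N := pow_le_pow_right₀ (by norm_num) h
  exact (Real.rpow_le_rpow (by positivity) h1 hγ).trans
    (Real.rpow_le_rpow_of_exponent_le (one_le_pow₀ (by norm_num)) hδ)

lemma factorial_rpow_le_gevreyWeight {ι : Type} [Fintype ι] {γ X : ℝ} (hγ : 0 ≤ γ) (hX : 1 ≤ X)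
    (hX' : ((2 : ℝ) ^ Fintype.card ι) ^ γ ≤ X) {N : ℕ} (p : ι → ℕ) (hN : ∑ i, p i ≤ N) :
    ((∑ i, p i).factorial : ℝ) ^ γ ≤ X ^ N * gevreyWeight (fun _ => γ) p := by
  refine (le_gevreyWeight_const hγ p).trans ?_
  have := gevreyWeight_pos (fun _ => γ) p
  gcongr
  exact (pow_le_pow_left₀ (by positivity) hX' _).trans (pow_le_pow_right₀ hX hN)

lemma factorial_add_rpow_le_of_le {γ X : ℝ} (hγ : 0 ≤ γ) (hX : 1 ≤ X)
    (hX' : (2 : ℝ) ^ γ ≤ X) {m n N : ℕ} (hN : m + n ≤ N) :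
    ((m + n).factorial : ℝ) ^ γ ≤ X ^ N * ((m.factorial : ℝ) ^ γ * (n.factorial : ℝ) ^ γ) := by
  refine (factorial_add_rpow_le hγ m n).trans ?_
  gcongr
  exact (pow_le_pow_left₀ (by positivity) hX' _).trans (pow_le_pow_right₀ hX hN)

lemma mixedWeight_le_of_le {θ₁ θ₂ X : ℝ} (h₂ : 0 ≤ θ₂) (hX : 1 ≤ X) (hX' : (2 : ℝ) ^ θ₂ ≤ X)
    {M s N : ℕ} (hN : M + s ≤ N) :
    mixedWeight θ₁ θ₂ M s ≤ X ^ N * ((M.factorial : ℝ) ^ θ₁ * (s.factorial : ℝ) ^ θ₂) := by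
  refine (mixedWeight_le h₂ M s).trans ?_
  gcongr
  exact (pow_le_pow_left₀ (by positivity) hX' _).trans (pow_le_pow_right₀ hX hN)

end Numeric

/-! ### Pointwise derivative bounds for the window. -/

section Window

variable {ν : Type} [Fintype ν] [DecidableEq ν] {α r : ℝ} {g : EuclideanSpace ℝ ν → ℂ}

lemma norm_multiDeriv_window_le (hα : 0 ≤ α) (hr : 0 < r)
    (hg : gsNorm (fun _ => α) (fun _ => 0) r g < ⊤) (c : ν → ℕ) (s : EuclideanSpace ℝ ν) :
    ‖multiDeriv c g s‖ ≤ (gsNorm (fun _ => α) (fun _ => 0) r g).toReal *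
      r⁻¹ ^ (∑ i, c i) * ((∑ i, c i).factorial : ℝ) ^ α := by
  have h := norm_monoDeriv_le hr hg 0 c s
  have e3 : gevreyWeight (fun _ => (0 : ℝ)) (0 : ν → ℕ) = 1 := by simp [gevreyWeight]
  rw [norm_monoDeriv, monomial_zero, abs_one, one_mul, e3] at h
  simp only [Pi.zero_apply, Finset.sum_const_zero, zero_add, one_mul] at h
  refine h.trans ?_
  gcongr
  exact gevreyWeight_const_le hα c

end Window

lemma sum_add_single {ι : Type} [Fintype ι] [DecidableEq ι] (p : ι → ℕ) (j : ι) (m : ℕ) :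
    ∑ i, (p + Pi.single j m : ι → ℕ) i = (∑ i, p i) + m := by
  simp [Finset.sum_add_distrib]

lemma sum_sub_single {ι : Type} [Fintype ι] [DecidableEq ι] {p : ι → ℕ} {j : ι} (h : p j ≠ 0) :
    (∑ i, (p - Pi.single j 1 : ι → ℕ) i) + 1 = ∑ i, p i := by
  have : p = (p - Pi.single j 1) + Pi.single j 1 := by
    funext i
    by_cases hi : i = j
    · subst hi; simp; omega
    · simp [hi]
  conv_rhs => rw [this]
  rw [sum_add_single]

/-! ### The directional transform maps steps boundedly to steps. -/

section Analysis

variable {k n : ℕ} {α β : ℝ} (u : Fin k → EuclideanSpace ℝ (Fin n))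

/-- The starting estimate, before any multiplication by ξ or differentiation. The power y^p is
included here because it comes from the support of g and the decay of φ, not from integration by
parts; hence P joins |a| in the factorial with exponent β. -/
lemma exists_analysis_base (hu : ∀ i, ‖u i‖ = 1) (hα : 0 ≤ α) (hβ : 0 ≤ β) {r : ℝ} (hr : 0 < r)
    (hr1 : r ≤ 1) {g : EuclideanSpace ℝ (Fin k) → ℂ}
    (hg : gsNorm (fun _ => α) (fun _ => 0) r g < ⊤) {a₀ : ℝ} (ha₀ : 0 < a₀) (ha₁ : a₀ ≤ 1) :
    ∃ C H : ℝ, 0 ≤ C ∧ 1 ≤ H ∧ ∀ φ : EuclideanSpace ℝ (Fin n) → ℂ,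
      gsNorm (fun _ => α) (fun _ => β) a₀ φ < ⊤ →
      ∀ (p : Fin k → ℕ) (a b : Fin n → ℕ) (c : Fin k → ℕ) (z : EuclideanSpace ℝ (Fin k ⊕ Fin n)),
      (∏ i, |z (Sum.inl i)| ^ p i) * ‖analysis u (monoDeriv a b φ) (multiDeriv c g) z‖ ≤
        C * (gsNorm (fun _ => α) (fun _ => β) a₀ φ).toReal *
          H ^ (((∑ i, a i) + ∑ i, p i) + ((∑ i, b i) + ∑ i, c i)) *
          mixedWeight β α ((∑ i, a i) + ∑ i, p i) ((∑ i, b i) + ∑ i, c i) := by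
  set Mg := (gsNorm (fun _ => α) (fun _ => 0) r g).toReal with hMg
  set R := r⁻¹ with hR
  set A := a₀⁻¹ with hA
  have hR1 : 1 ≤ R := (one_le_inv₀ hr).2 hr1
  have hA1 : 1 ≤ A := (one_le_inv₀ ha₀).2 ha₁
  have hB1 : (1 : ℝ) ≤ 2 ^ β := Real.one_le_rpow (by norm_num) hβ
  have hMg0 : 0 ≤ Mg := ENNReal.toReal_nonneg
  set N₀ := n + 1 with hN₀
  set J := ∫ x : EuclideanSpace ℝ (Fin n), decayWeight x with hJ
  have hJ0 : 0 ≤ J := MeasureTheory.integral_nonneg fun x => decayWeight_nonneg x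
  set C₀ : ℝ := (n + 1) ^ N₀ * A ^ N₀ * ((2 : ℝ) ^ β) ^ N₀ * (N₀.factorial : ℝ) ^ β * (n + 1) * Mg
    with hC₀
  set H : ℝ := (1 + R) * (n + 1) * A * 2 ^ β * R with hH
  have hn1 : (1 : ℝ) ≤ n + 1 := by linarith [(Nat.cast_nonneg n : (0 : ℝ) ≤ n)]
  have hH1 : 1 ≤ H := by
    have h1 : (1 : ℝ) ≤ 1 + R := by linarith
    have h2 := one_le_mul_of_one_le_of_one_le h1 hn1
    have h3 := one_le_mul_of_one_le_of_one_le h2 hA1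
    have h4 := one_le_mul_of_one_le_of_one_le h3 hB1
    exact one_le_mul_of_one_le_of_one_le h4 hR1
  refine ⟨C₀ * J, H, by positivity, hH1, fun φ hφ p a b c z => ?_⟩
  set σ := (gsNorm (fun _ => α) (fun _ => β) a₀ φ).toReal with hσ
  have hσ0 : 0 ≤ σ := ENNReal.toReal_nonneg
  set q := ∑ i, a i with hq
  set P := ∑ i, p i with hP
  set m := ∑ i, b i with hm
  set mc := ∑ i, c i with hmc
  set e := (q + P) + (m + mc) with he
  have hprod0 : 0 ≤ ∏ i, |z (Sum.inl i)| ^ p i := Finset.prod_nonneg fun _ _ => by positivity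
  have hpt : ∀ x, (∏ i, |z (Sum.inl i)| ^ p i) * (‖monoDeriv a b φ x‖ *
      ‖multiDeriv c g (dirsL u x + negFst k n z)‖) ≤
      C₀ * σ * H ^ e * mixedWeight β α (q + P) (m + mc) * decayWeight x := by
    intro x
    have hmw := mixedWeight_nonneg β α (q + P) (m + mc)
    -- Only points x where the window does not vanish contribute, and there y is controlled by x.
    by_cases hG : multiDeriv c g (dirsL u x + negFst k n z) = 0
    · rw [hG, norm_zero, mul_zero, mul_zero]
      have := decayWeight_nonneg x
      positivity
    refine le_mul_decayWeight ?_
    rw [Fintype.card_fin, ← hN₀]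
    have hy : ∀ i, |z (Sum.inl i)| ≤ (1 + R) * (1 + ‖x‖) := by
      intro i
      have h1 : |(dirsL u x + negFst k n z) i| ≤ R := by
        by_contra hlt
        exact hG (eq_zero_of_decay_zero hr hg i c _ (not_le.1 hlt))
      rw [PiLp.add_apply, negFst_apply] at h1
      have h2 := abs_dirsL_le hu x i
      have h3 := abs_sub_abs_le_abs_sub (z (Sum.inl i)) (dirsL u x i)
      rw [abs_sub_comm, sub_eq_add_neg (dirsL u x i)] at h3
      have := norm_nonneg x
      nlinarith
    have hprod : (∏ i, |z (Sum.inl i)| ^ p i) ≤ (1 + R) ^ P * (1 + ‖x‖) ^ P := by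
      rw [← mul_pow, hP, ← Finset.prod_pow_eq_pow_sum]
      exact Finset.prod_le_prod (fun _ _ => by positivity) fun i _ =>
        pow_le_pow_left₀ (abs_nonneg _) (hy i) _
    -- P powers compensate y^p, and the remaining N₀ = n + 1 make the integrand integrable.
    have hf := one_add_norm_pow_mul_monoDeriv_le ha₀ ha₁ hφ (P + N₀) a b x
    have hgw : gevreyWeight (fun _ => β) a +
        ∑ j, gevreyWeight (fun _ => β) (a + Pi.single j (P + N₀)) ≤
        (n + 1) * (((2 : ℝ) ^ β) ^ (q + P + N₀) *
          (((q + P).factorial : ℝ) ^ β * (N₀.factorial : ℝ) ^ β)) := by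
      have hadd := factorial_add_rpow_le hβ (q + P) N₀
      have h0 : gevreyWeight (fun _ => β) a ≤ ((q + P + N₀).factorial : ℝ) ^ β := by
        refine (gevreyWeight_const_le hβ a).trans ?_
        refine Real.rpow_le_rpow (by positivity) ?_ hβ
        exact_mod_cast Nat.factorial_le (by omega)
      have h1 : ∀ j, gevreyWeight (fun _ => β) (a + Pi.single j (P + N₀)) ≤
          ((q + P + N₀).factorial : ℝ) ^ β := by
        intro j
        refine (gevreyWeight_const_le hβ _).trans (le_of_eq ?_)
        rw [sum_add_single, ← add_assoc]
      have h2 : ∑ j, gevreyWeight (fun _ => β) (a + Pi.single j (P + N₀)) ≤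
          n * ((q + P + N₀).factorial : ℝ) ^ β := by
        simpa using Finset.sum_le_card_nsmul Finset.univ _ _ fun j _ => h1 j
      have h3 : (n + 1 : ℝ) * ((q + P + N₀).factorial : ℝ) ^ β ≤ (n + 1) *
          (((2 : ℝ) ^ β) ^ (q + P + N₀) * (((q + P).factorial : ℝ) ^ β *
          (N₀.factorial : ℝ) ^ β)) := by gcongr
      linarith
    have hgb := gevreyWeight_const_le hα b
    have hwin := norm_multiDeriv_window_le hα hr hg c (dirsL u x + negFst k n z)
    have hbc := factorial_rpow_mul_le hα m mc
    have hw := le_mixedWeight (θ₁ := β) hα (q + P) (m + mc)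
    have hgwp : 0 ≤ gevreyWeight (fun _ => β) a +
        ∑ j, gevreyWeight (fun _ => β) (a + Pi.single j (P + N₀)) :=
      add_nonneg (gevreyWeight_nonneg _ _) (Finset.sum_nonneg fun _ _ => gevreyWeight_nonneg _ _)
    have pw : ∀ {X : ℝ}, 1 ≤ X → ∀ {i}, i ≤ e → X ^ i ≤ X ^ e := fun hX _ hi =>
      pow_le_pow_right₀ hX hi
    calc (1 + ‖x‖) ^ N₀ * ((∏ i, |z (Sum.inl i)| ^ p i) * (‖monoDeriv a b φ x‖ *
          ‖multiDeriv c g (dirsL u x + negFst k n z)‖))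
        ≤ (1 + ‖x‖) ^ N₀ * (((1 + R) ^ P * (1 + ‖x‖) ^ P) * (‖monoDeriv a b φ x‖ *
          (Mg * R ^ mc * (mc.factorial : ℝ) ^ α))) := by gcongr
      _ = (1 + R) ^ P * ((1 + ‖x‖) ^ (P + N₀) * ‖monoDeriv a b φ x‖) *
          (Mg * R ^ mc * (mc.factorial : ℝ) ^ α) := by rw [pow_add]; ring
      _ ≤ (1 + R) ^ P * ((n + 1) ^ (P + N₀) * σ * A ^ (q + (P + N₀) + m) *
          (m.factorial : ℝ) ^ α * ((n + 1) * (((2 : ℝ) ^ β) ^ (q + P + N₀) *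
          (((q + P).factorial : ℝ) ^ β * (N₀.factorial : ℝ) ^ β)))) *
          (Mg * R ^ mc * (mc.factorial : ℝ) ^ α) := by
          refine mul_le_mul_of_nonneg_right (mul_le_mul_of_nonneg_left ?_ (by positivity))
            (by positivity)
          rw [Fintype.card_fin] at hf
          refine hf.trans ?_
          gcongr
      _ = C₀ * σ * ((1 + R) ^ P * (n + 1) ^ P * A ^ (q + P + m) * ((2 : ℝ) ^ β) ^ (q + P) *
          R ^ mc) * (((q + P).factorial : ℝ) ^ β *
            ((m.factorial : ℝ) ^ α * (mc.factorial : ℝ) ^ α)) := by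
          rw [hC₀, show q + (P + N₀) + m = q + P + m + N₀ by ring, pow_add _ P N₀,
            pow_add A, pow_add _ (q + P) N₀]
          ring
      _ ≤ C₀ * σ * ((1 + R) ^ e * (n + 1) ^ e * A ^ e * ((2 : ℝ) ^ β) ^ e * R ^ e) *
          (((q + P).factorial : ℝ) ^ β * ((m + mc).factorial : ℝ) ^ α) := by
          have hRp : (1 : ℝ) ≤ 1 + R := by linarith
          have i1 := pw hRp (show P ≤ e by omega)
          have i2 := pw hn1 (show P ≤ e by omega)
          have i3 := pw hA1 (show q + P + m ≤ e by omega)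
          have i4 := pw hB1 (show q + P ≤ e by omega)
          have i5 := pw hR1 (show mc ≤ e by omega)
          gcongr
      _ = C₀ * σ * H ^ e * (((q + P).factorial : ℝ) ^ β * ((m + mc).factorial : ℝ) ^ α) := by
          rw [hH, mul_pow, mul_pow, mul_pow, mul_pow]
      _ ≤ _ := by gcongr
  refine (mul_norm_oscIntegral_le _ _ _ hprod0 hpt).trans (le_of_eq ?_)
  ring

variable {u}

lemma pderiv_analysis_inl {f : EuclideanSpace ℝ (Fin n) → ℂ} {g : EuclideanSpace ℝ (Fin k) → ℂ}
    (hf : RapidDecay f) (hg : IsBump g) (i : Fin k) :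
    pderiv (Sum.inl i) (analysis u f g) = (-1 : ℂ) • analysis u f (pderiv i g) := by
  have h0 : (fun x => (((-freqPairing k n) x (EuclideanSpace.single (Sum.inl i) 1) : ℝ) : ℂ) *
      f x) = 0 := by
    funext x
    simp [freqPairing_single_inl]
  rw [analysis, pderiv_oscIntegral _ _ _ hf hg, h0, oscIntegral_zero_left, smul_zero, add_zero,
    Finset.sum_eq_single i (fun j _ hj => by simp [negFst_apply, hj]) (by simp)]
  simp [negFst_apply, analysis]

lemma pderiv_analysis_inr {f : EuclideanSpace ℝ (Fin n) → ℂ} {g : EuclideanSpace ℝ (Fin k) → ℂ}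
    (hf : RapidDecay f) (hg : IsBump g) (j : Fin n) :
    pderiv (Sum.inr j) (analysis u f g) =
      (-(2 * Real.pi * Complex.I) : ℂ) • analysis u (fun x => (x j : ℂ) * f x) g := by
  have h0 : (fun x => (((-freqPairing k n) x (EuclideanSpace.single (Sum.inr j) 1) : ℝ) : ℂ) *
      f x) = (-1 : ℂ) • fun x => (x j : ℂ) * f x := by
    funext x
    simp [freqPairing_single_inr]
  rw [analysis, pderiv_oscIntegral _ _ _ hf hg, h0, oscIntegral_smul_left,
    Finset.sum_eq_zero (fun j _ => by simp [negFst_apply]), zero_add, smul_smul, analysis]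
  simp

lemma norm_two_pi_I : ‖(2 * Real.pi * Complex.I : ℂ)‖ = 2 * Real.pi := by
  simp [abs_of_pos Real.pi_pos]

lemma one_le_two_pi : (1 : ℝ) ≤ 2 * Real.pi := by linarith [Real.pi_gt_three]

/-- The factor 2π ≥ 1 is dropped, and the window coefficients are coordinates of the unit vectors
u_i, hence at most 1 in modulus. The recurrence thus has no constants besides a_j. -/
lemma abs_coord_mul_analysis_le (hu : ∀ i, ‖u i‖ = 1) {a₀ : ℝ} (ha₀ : 0 < a₀)
    {φ : EuclideanSpace ℝ (Fin n) → ℂ} (hsm : ContDiff ℝ ∞ φ) {γ δ : Fin n → ℝ}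
    (hφ : gsNorm γ δ a₀ φ < ⊤) {g : EuclideanSpace ℝ (Fin k) → ℂ} (hg : IsBump g)
    (a b : Fin n → ℕ) (j : Fin n) (z : EuclideanSpace ℝ (Fin k ⊕ Fin n)) :
    |z (Sum.inr j)| * ‖analysis u (monoDeriv a b φ) g z‖ ≤
      a j * ‖analysis u (monoDeriv (a - Pi.single j 1) b φ) g z‖ +
      (‖analysis u (monoDeriv a (b + Pi.single j 1) φ) g z‖ +
        ∑ i, ‖analysis u (monoDeriv a b φ) (pderiv i g) z‖) := by
  have h := congrArg norm (coord_mul_oscIntegral (dirsL u) (negFst k n) (-freqPairing k n)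
    hsm ha₀ hφ hg a b j z)
  rw [norm_mul, norm_mul, norm_two_pi_I, norm_neg, Complex.norm_real] at h
  have e1 : ‖(-freqPairing k n) (EuclideanSpace.single j 1) z‖ = |z (Sum.inr j)| := by
    simp [freqPairing_single_left]
  rw [e1] at h
  have h2 : |z (Sum.inr j)| * ‖analysis u (monoDeriv a b φ) g z‖ ≤
      2 * Real.pi * |z (Sum.inr j)| * ‖analysis u (monoDeriv a b φ) g z‖ := by
    have := one_le_two_pi
    have h0 : 0 ≤ |z (Sum.inr j)| * ‖analysis u (monoDeriv a b φ) g z‖ := by positivity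
    nlinarith
  refine h2.trans (h.le.trans ?_)
  refine (norm_add_le _ _).trans ?_
  rw [← add_assoc]
  refine add_le_add ((norm_add_le _ _).trans (add_le_add (le_of_eq ?_) le_rfl))
    ((norm_sum_le _ _).trans (Finset.sum_le_sum fun i _ => ?_))
  · rw [norm_mul, Complex.norm_natCast]; rfl
  · rw [norm_mul, Complex.norm_real]
    have h3 : ‖dirsL u (EuclideanSpace.single j 1) i‖ ≤ 1 := by
      simpa using abs_dirsL_le hu (EuclideanSpace.single j 1) i
    exact mul_le_of_le_one_left (norm_nonneg _) h3

/-- Multiplication by ξ_j is integration by parts, ∂_y differentiates the window, and ∂_ξ multiplies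
by t. Collecting degrees gives (|y-powers| + |ξ-derivatives|)!^β (|ξ-powers| + |y-derivatives|)!^α
up to geometric factors, which is the weight of the target space. -/
lemma exists_gsNorm_analysis_le (hu : ∀ i, ‖u i‖ = 1) (hα : 0 ≤ α) (hβ : 0 ≤ β)
    (hαβ : 1 ≤ β + α) {r : ℝ} (hr : 0 < r)
    {g : EuclideanSpace ℝ (Fin k) → ℂ} (hgs : ContDiff ℝ ∞ g)
    (hg : gsNorm (fun _ => α) (fun _ => 0) r g < ⊤) {a₀ : ℝ} (ha₀ : 0 < a₀) :
    ∃ b C : ℝ, 0 < b ∧ 0 ≤ C ∧ ∀ φ : EuclideanSpace ℝ (Fin n) → ℂ, ContDiff ℝ ∞ φ →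
      gsNorm (fun _ => α) (fun _ => β) a₀ φ < ⊤ →
      gsNorm (Sum.elim (fun _ => α) (fun _ => β)) (Sum.elim (fun _ => β) (fun _ => α)) b
        (analysis u φ g) ≤
        ENNReal.ofReal (C * (gsNorm (fun _ => α) (fun _ => β) a₀ φ).toReal) := by
  wlog hr1 : r ≤ 1 generalizing r
  · exact this one_pos ((gsNorm_mono _ _ zero_le_one (not_le.1 hr1).le g).trans_lt hg) le_rfl
  wlog ha₁ : a₀ ≤ 1 generalizing a₀
  · obtain ⟨b, C, hb, hC, h⟩ := this one_pos le_rfl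
    refine ⟨b, C, hb, hC, fun φ hsm hφ => ?_⟩
    have hle := gsNorm_mono (fun _ => α) (fun _ => β) zero_le_one (not_le.1 ha₁).le φ
    refine (h φ hsm (hle.trans_lt hφ)).trans (ENNReal.ofReal_le_ofReal ?_)
    gcongr
    exact hφ.ne
  obtain ⟨C, H, hC, hH, hbase⟩ := exists_analysis_base u hu hα hβ hr hr1 hg ha₀ ha₁
  have hgb := isBump_multiDeriv hgs hr hg
  set X : ℝ := ((2 : ℝ) ^ (k + n + 1)) ^ (α + β) with hX
  have hX1 : 1 ≤ X := Real.one_le_rpow (one_le_pow₀ (by norm_num)) (by linarith)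
  have hXα : (2 : ℝ) ^ α ≤ X := by
    simpa using two_pow_rpow_le hα (by linarith : α ≤ α + β) (show 1 ≤ k + n + 1 by omega)
  have hXβ : (2 : ℝ) ^ β ≤ X := by
    simpa using two_pow_rpow_le hβ (by linarith : β ≤ α + β) (show 1 ≤ k + n + 1 by omega)
  set L : ℝ := (Fintype.card (Option (Fin k)) : ℝ) + 1 with hL
  have hL1 : 1 ≤ L := by
    have : (0 : ℝ) ≤ (Fintype.card (Option (Fin k)) : ℝ) := Nat.cast_nonneg _
    linarith
  -- One factor for each geometric loss: 2π per derivative, L per multiplication by ξ, H from the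
  -- base estimate, and X for each of the seven weight comparisons `w1`, `w2`, `w3`, `g1`, ...,
  -- `g4`.
  set B : ℝ := 2 * Real.pi * L * H * X ^ 7 with hB
  have h2π := one_le_two_pi
  have hB0 : 0 < B := by positivity
  refine ⟨B⁻¹, C, inv_pos.2 hB0, hC, fun φ hsm hφ => ?_⟩
  set σ := (gsNorm (fun _ => α) (fun _ => β) a₀ φ).toReal with hσ
  have hσ0 : 0 ≤ σ := ENNReal.toReal_nonneg
  have hfd := rapidDecay_monoDeriv hsm ha₀ hφ
  refine gsNorm_le_of_norm_monoDeriv_le (inv_pos.2 hB0) fun p q z => ?_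
  rw [inv_inv]
  -- states are triples (a, b, c), standing for the pair (t^a φ^(b), g^(c))
  let S := (Fin n → ℕ) × (Fin n → ℕ) × (Fin k → ℕ)
  let Θ : S → EuclideanSpace ℝ (Fin k ⊕ Fin n) → ℂ := fun s =>
    analysis u (monoDeriv s.1 s.2.1 φ) (multiDeriv s.2.2 g)
  let pl : Fin k → ℕ := fun i => p (Sum.inl i)
  let pr : Fin n → ℕ := fun i => p (Sum.inr i)
  let ql : Fin k → ℕ := fun i => q (Sum.inl i)
  let qr : Fin n → ℕ := fun i => q (Sum.inr i)
  set P := ∑ i, pl i with hP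
  set P' := ∑ i, pr i with hP'
  set Q := ∑ i, ql i with hQ
  set Q' := ∑ i, qr i with hQ'
  have hsp : ∑ i, p i = P + P' := Fintype.sum_sum_type _
  have hsq : ∑ i, q i = Q + Q' := Fintype.sum_sum_type _
  set r₀ := ∏ i, |z (Sum.inl i)| ^ pl i with hr₀
  have hr₀0 : 0 ≤ r₀ := Finset.prod_nonneg fun _ _ => by positivity
  obtain ⟨v, hv⟩ := exists_list_count pr
  have hmon : |monomial p z| = (v.map fun j => |z (Sum.inr j)|).prod * r₀ := by
    rw [prod_map_eq_of_count hv, monomial, Finset.abs_prod, Fintype.prod_sum_type, mul_comm]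
    simp only [abs_pow, hr₀, pl, pr]
  have hvl : v.length = P' := length_eq_of_count hv
  have hmul : ∀ s : S, |monomial p z| * ‖Θ s z‖ ≤ C * σ * L ^ P' *
      H ^ (P' + (((∑ i, s.1 i) + P) + ((∑ i, s.2.1 i) + ∑ i, s.2.2 i))) *
      mixedWeight β α ((∑ i, s.1 i) + P) (P' + ((∑ i, s.2.1 i) + ∑ i, s.2.2 i)) := by
    intro s
    rw [hmon, mul_assoc, ← hvl]
    -- `none` stands for the derivative falling on φ^(b), and `some i` for the i-th partial
    -- derivative of the window; both raise s. Hitting the monomial lowers M.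
    refine list_prod_mul_le_mixedWeight (I := Option (Fin k)) hβ hα hαβ
      (fun s : S => r₀ * ‖Θ s z‖) (fun s => (∑ i, s.1 i) + P)
      (fun s => (∑ i, s.2.1 i) + ∑ i, s.2.2 i) (fun j => |z (Sum.inr j)|)
      (fun j => abs_nonneg _) (by positivity) hH (fun s => hbase φ hφ pl s.1 s.2.1 s.2.2 z)
      (fun s j => ⟨s.1 j, (s.1 - Pi.single j 1, s.2.1, s.2.2), fun o => o.elim
        (s.1, s.2.1 + Pi.single j 1, s.2.2) fun i => (s.1, s.2.1, s.2.2 + Pi.single i 1),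
        ?_, ?_, ?_⟩) v s
    · have h := mul_le_mul_of_nonneg_left (abs_coord_mul_analysis_le hu ha₀ hsm hφ
        (hgb s.2.2) s.1 s.2.1 j z) hr₀0
      simp only [pderiv_multiDeriv _ _ hgs] at h
      rw [Fintype.sum_option]
      simp only [Option.elim_none, Option.elim_some, Θ]
      rw [← Finset.mul_sum]
      linarith
    · by_cases h0 : s.1 j = 0
      · exact Or.inl h0
      · refine Or.inr ⟨?_, ?_, rfl⟩
        · have := sum_sub_single h0
          simp only
          omega
        · have := Finset.single_le_sum (f := s.1) (fun _ _ => Nat.zero_le _) (Finset.mem_univ j)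
          omega
    · rintro (_ | i)
      · simp only [Option.elim_none, sum_add_single]
        exact ⟨trivial, by omega⟩
      · simp only [Option.elim_some, sum_add_single]
        exact ⟨trivial, by omega⟩
  obtain ⟨w, hw, hwd⟩ := exists_multiDeriv_eq_wordDeriv q
  -- The monomial |z^p| is a fixed number here: it was treated for all states at once in `hmul`, so
  -- no Leibniz terms between z^p and ∂^q occur.
  have hder := norm_wordDeriv_le (I := Unit) Θ
    (fun s => oscIntegral_contDiff _ _ _ (hfd s.1 s.2.1) (hgb s.2.2))
    (fun s => ∑ i, s.1 i) (fun s => (∑ i, s.2.1 i) + ∑ i, s.2.2 i)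
    (Sum.elim (fun _ => 0) fun _ => 1) (Sum.elim (fun _ => 1) fun _ => 0)
    (D := 2 * Real.pi) (by positivity)
    (fun s l => by
      rcases l with i | j
      · refine ⟨fun _ => -1, fun _ => (s.1, s.2.1, s.2.2 + Pi.single i 1), ?_, fun _ => ?_⟩
        · simp only [Finset.univ_unique, Finset.sum_singleton, Θ]
          rw [pderiv_analysis_inl (hfd _ _) (hgb _), pderiv_multiDeriv _ _ hgs]
        · simp only [norm_neg, norm_one, sum_add_single]
          exact ⟨h2π, rfl, by simp only [Sum.elim_inl]; omega⟩
      · refine ⟨fun _ => -(2 * Real.pi * Complex.I), fun _ => (s.1 + Pi.single j 1, s.2.1, s.2.2),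
          ?_, fun _ => ?_⟩
        · simp only [Finset.univ_unique, Finset.sum_singleton, Θ]
          rw [pderiv_analysis_inr (hfd _ _) (hgb _)]
          simp only [coord_mul_monoDeriv]
        · rw [norm_neg, norm_two_pi_I]
          simp only [sum_add_single]
          exact ⟨le_rfl, rfl, rfl⟩)
    (z := z) (abs_nonneg (monomial p z))
    (fun M s => C * σ * L ^ P' * H ^ (P' + ((M + P) + s)) * mixedWeight β α (M + P) (P' + s))
    hmul w (0, 0, 0)
  have hΘ0 : Θ (0, 0, 0) = analysis u φ g := by simp [Θ]
  rw [hΘ0, ← hwd, ← norm_monoDeriv, length_eq_of_count hw, sum_map_eq_of_count hw,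
    sum_map_eq_of_count hw] at hder
  simp only [Fintype.sum_sum_type, Sum.elim_inl, Sum.elim_inr, mul_zero, mul_one,
    Finset.sum_const_zero, add_zero, zero_add, Pi.zero_apply, Fintype.card_unit, Nat.cast_one]
    at hder
  change _ ≤ (2 * Real.pi) ^ (Q + Q') * (C * σ * L ^ P' * H ^ (P' + ((Q' + P) + Q)) *
    mixedWeight β α (Q' + P) (P' + Q)) at hder
  refine hder.trans ?_
  rw [hsp, hsq, gevreyWeight_sumElim, gevreyWeight_sumElim]
  change _ ≤ C * σ * B ^ (P + P' + (Q + Q')) *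
    (gevreyWeight (fun _ => β) pl * gevreyWeight (fun _ => α) pr *
      (gevreyWeight (fun _ => α) ql * gevreyWeight (fun _ => β) qr))
  set N := P + P' + (Q + Q') with hN
  have w1 := mixedWeight_le_of_le (θ₁ := β) hα hX1 hXα (show (Q' + P) + (P' + Q) ≤ N by omega)
  have w2 := factorial_add_rpow_le_of_le hβ hX1 hXβ (show Q' + P ≤ N by omega)
  have w3 := factorial_add_rpow_le_of_le hα hX1 hXα (show P' + Q ≤ N by omega)
  have cX : ∀ {γ : ℝ} {m : ℕ}, 0 ≤ γ → γ ≤ α + β → m ≤ k + n + 1 →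
      ((2 : ℝ) ^ Fintype.card (Fin m)) ^ γ ≤ X := fun h1 h2 h3 =>
    two_pow_rpow_le h1 h2 (by simpa using h3)
  have g1 := factorial_rpow_le_gevreyWeight (N := N) hβ hX1
    (cX hβ (by linarith) (by omega)) pl (by omega)
  have g2 := factorial_rpow_le_gevreyWeight (N := N) hα hX1
    (cX hα (by linarith) (by omega)) pr (by omega)
  have g3 := factorial_rpow_le_gevreyWeight (N := N) hα hX1
    (cX hα (by linarith) (by omega)) ql (by omega)
  have g4 := factorial_rpow_le_gevreyWeight (N := N) hβ hX1
    (cX hβ (by linarith) (by omega)) qr (by omega)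
  have n1 := gevreyWeight_nonneg (fun _ => β) pl
  have n2 := gevreyWeight_nonneg (fun _ => α) pr
  have n3 := gevreyWeight_nonneg (fun _ => α) ql
  have n4 := gevreyWeight_nonneg (fun _ => β) qr
  rw [← hP] at g1
  rw [← hP'] at g2
  rw [← hQ] at g3
  rw [← hQ'] at g4
  have hmix : mixedWeight β α (Q' + P) (P' + Q) ≤ X ^ N *
      ((X ^ N * ((X ^ N * gevreyWeight (fun _ => β) qr) * (X ^ N * gevreyWeight (fun _ => β) pl))) *
      (X ^ N * ((X ^ N * gevreyWeight (fun _ => α) pr) *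
        (X ^ N * gevreyWeight (fun _ => α) ql)))) := by
    refine w1.trans ?_
    gcongr
    · exact w2.trans (by gcongr)
    · exact w3.trans (by gcongr)
  calc (2 * Real.pi) ^ (Q + Q') * (C * σ * L ^ P' * H ^ (P' + ((Q' + P) + Q)) *
        mixedWeight β α (Q' + P) (P' + Q))
      ≤ (2 * Real.pi) ^ N * (C * σ * L ^ N * H ^ N * (X ^ N *
      ((X ^ N * ((X ^ N * gevreyWeight (fun _ => β) qr) * (X ^ N * gevreyWeight (fun _ => β) pl))) *
      (X ^ N * ((X ^ N * gevreyWeight (fun _ => α) pr) *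
        (X ^ N * gevreyWeight (fun _ => α) ql)))))) := by
        have i1 : (2 * Real.pi) ^ (Q + Q') ≤ (2 * Real.pi) ^ N :=
          pow_le_pow_right₀ h2π (by omega)
        have i2 : L ^ P' ≤ L ^ N := pow_le_pow_right₀ hL1 (by omega)
        have i3 : H ^ (P' + ((Q' + P) + Q)) ≤ H ^ N := pow_le_pow_right₀ hH (by omega)
        have := mixedWeight_nonneg β α (Q' + P) (P' + Q)
        gcongr
    _ = _ := by
        have hBN : B ^ N = (2 * Real.pi) ^ N * L ^ N * H ^ N * (X ^ N) ^ 7 := by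
          rw [hB, mul_pow, mul_pow, mul_pow, ← pow_mul X 7 N, mul_comm 7 N, pow_mul X N 7]
        rw [hBN]
        ring

end Analysis

/-! ### The synthesis operator maps steps boundedly to steps. -/

section Synthesis

variable {k n : ℕ} {α β : ℝ} (u : Fin k → EuclideanSpace ℝ (Fin n))

/-- Extension by zero of a multi-index in the frequency variables. -/
def freqIndex (k : ℕ) {n : ℕ} (a : Fin n → ℕ) : Fin k ⊕ Fin n → ℕ :=
  Sum.elim 0 a

lemma sum_freqIndex (a : Fin n → ℕ) : ∑ i, freqIndex k a i = ∑ j, a j := by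
  simp [freqIndex]

lemma freqIndex_add_single (a : Fin n → ℕ) (j : Fin n) (m : ℕ) :
    freqIndex k a + Pi.single (Sum.inr j) m = freqIndex k (a + Pi.single j m) := by
  funext l
  rcases l with i | i
  · simp [freqIndex]
  · by_cases h : i = j
    · subst h; simp [freqIndex]
    · simp [freqIndex, h]

lemma freqIndex_sub_single (a : Fin n → ℕ) (j : Fin n) (m : ℕ) :
    freqIndex k a - Pi.single (Sum.inr j) m = freqIndex k (a - Pi.single j m) := by
  funext l
  rcases l with i | i
  · simp [freqIndex]
  · by_cases h : i = j
    · subst h; simp [freqIndex]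
    · simp [freqIndex, h]

lemma gevreyWeight_freqIndex (γ δ : ℝ) (a : Fin n → ℕ) :
    gevreyWeight (Sum.elim (fun _ => γ) (fun _ => δ)) (freqIndex k a) =
      gevreyWeight (fun _ => δ) a := by
  rw [gevreyWeight_sumElim]
  simp [freqIndex, gevreyWeight]

/-- The N extra powers needed for integrability over (y, ξ) may fall on either kind of variable,
with different exponents; the right-hand side dominates both cases. -/
lemma gevreyWeight_freqIndex_add_le (hα : 0 ≤ α) (hβ : 0 ≤ β) (a : Fin n → ℕ) (N : ℕ)
    (l : Fin k ⊕ Fin n) :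
    gevreyWeight (Sum.elim (fun _ => β) (fun _ => α)) (freqIndex k a + Pi.single l N) ≤
      (N.factorial : ℝ) ^ β * (((∑ j, a j) + N).factorial : ℝ) ^ α := by
  rcases l with i | j
  · rw [gevreyWeight_sumElim]
    have e1 : (fun i' => (freqIndex k a + Pi.single (Sum.inl i) N : Fin k ⊕ Fin n → ℕ)
        (Sum.inl i')) = Pi.single i N := by
      funext i'
      by_cases h : i' = i
      · subst h; simp [freqIndex]
      · simp [freqIndex, h]
    have e2 : (fun j => (freqIndex k a + Pi.single (Sum.inl i) N : Fin k ⊕ Fin n → ℕ)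
        (Sum.inr j)) = a := by
      funext j; simp [freqIndex]
    rw [e1, e2]
    have h1 := gevreyWeight_const_le hβ (Pi.single i N : Fin k → ℕ)
    have h2 := gevreyWeight_const_le hα a
    have h3 : ((∑ j, a j).factorial : ℝ) ^ α ≤ (((∑ j, a j) + N).factorial : ℝ) ^ α :=
      Real.rpow_le_rpow (by positivity)
        (by exact_mod_cast Nat.factorial_le (Nat.le_add_right _ _)) hα
    rw [Finset.sum_pi_single' , if_pos (Finset.mem_univ _)] at h1
    exact mul_le_mul h1 (h2.trans h3) (gevreyWeight_nonneg _ _) (by positivity)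
  · rw [freqIndex_add_single, gevreyWeight_freqIndex]
    refine (gevreyWeight_const_le hα _).trans ?_
    rw [sum_add_single]
    exact le_mul_of_one_le_left (by positivity) (one_le_factorial_rpow hβ N)

/-- Powers of ξ and derivatives of the window both carry the exponent α, so |a| and |c| merge into
one factorial, while ξ-derivatives carry β. The index in y stays zero, because neither recurrence
ever produces powers of y or y-derivatives. -/
lemma exists_synthesis_base (hα : 0 ≤ α) (hβ : 0 ≤ β) {r : ℝ} (hr : 0 < r)
    (hr1 : r ≤ 1) {g : EuclideanSpace ℝ (Fin k) → ℂ}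
    (hg : gsNorm (fun _ => α) (fun _ => 0) r g < ⊤) {a₀ : ℝ} (ha₀ : 0 < a₀) (ha₁ : a₀ ≤ 1) :
    ∃ C H : ℝ, 0 ≤ C ∧ 1 ≤ H ∧ ∀ Φ : EuclideanSpace ℝ (Fin k ⊕ Fin n) → ℂ,
      gsNorm (Sum.elim (fun _ => α) (fun _ => β)) (Sum.elim (fun _ => β) (fun _ => α)) a₀ Φ < ⊤ →
      ∀ (a b : Fin n → ℕ) (c : Fin k → ℕ) (z : EuclideanSpace ℝ (Fin n)),
      ‖synthesis u (monoDeriv (freqIndex k a) (freqIndex k b) Φ) (multiDeriv c g) z‖ ≤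
        C * (gsNorm (Sum.elim (fun _ => α) (fun _ => β)) (Sum.elim (fun _ => β) (fun _ => α))
          a₀ Φ).toReal *
          H ^ (((∑ i, a i) + ∑ i, c i) + ∑ i, b i) *
          mixedWeight α β ((∑ i, a i) + ∑ i, c i) (∑ i, b i) := by
  set Mg := (gsNorm (fun _ => α) (fun _ => 0) r g).toReal with hMg
  set R := r⁻¹ with hR
  set A := a₀⁻¹ with hA
  have hR1 : 1 ≤ R := (one_le_inv₀ hr).2 hr1
  have hA1 : 1 ≤ A := (one_le_inv₀ ha₀).2 ha₁
  have hB1 : (1 : ℝ) ≤ 2 ^ α := Real.one_le_rpow (by norm_num) hα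
  have hMg0 : 0 ≤ Mg := ENNReal.toReal_nonneg
  set d : ℝ := (Fintype.card (Fin k ⊕ Fin n) : ℝ) + 1 with hd
  have hd0 : 0 ≤ d := by positivity
  set N₀ := Fintype.card (Fin k ⊕ Fin n) + 1 with hN₀
  set J := ∫ x : EuclideanSpace ℝ (Fin k ⊕ Fin n), decayWeight x with hJ
  have hJ0 : 0 ≤ J := MeasureTheory.integral_nonneg fun x => decayWeight_nonneg x
  set C₀ : ℝ := d ^ N₀ * A ^ N₀ * (d * ((N₀.factorial : ℝ) ^ β *
    (((2 : ℝ) ^ α) ^ N₀ * (N₀.factorial : ℝ) ^ α))) * Mg with hC₀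
  set H : ℝ := A * 2 ^ α * R with hH
  have hH1 : 1 ≤ H :=
    one_le_mul_of_one_le_of_one_le (one_le_mul_of_one_le_of_one_le hA1 hB1) hR1
  refine ⟨C₀ * J, H, by positivity, hH1, fun Φ hΦ a b c z => ?_⟩
  set σ := (gsNorm (Sum.elim (fun _ => α) (fun _ => β)) (Sum.elim (fun _ => β) (fun _ => α))
    a₀ Φ).toReal with hσ
  have hσ0 : 0 ≤ σ := ENNReal.toReal_nonneg
  set q := ∑ i, a i with hq
  set m := ∑ i, b i with hm
  set mc := ∑ i, c i with hmc
  set e := (q + mc) + m with he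
  have hpt : ∀ x, (1 : ℝ) * (‖monoDeriv (freqIndex k a) (freqIndex k b) Φ x‖ *
      ‖multiDeriv c g (negFst k n x + dirsL u z)‖) ≤
      C₀ * σ * H ^ e * mixedWeight α β (q + mc) m * decayWeight x := by
    intro x
    refine le_mul_decayWeight ?_
    rw [← hN₀, one_mul]
    have hf := one_add_norm_pow_mul_monoDeriv_le ha₀ ha₁ hΦ N₀ (freqIndex k a) (freqIndex k b) x
    rw [gevreyWeight_freqIndex, gevreyWeight_freqIndex, sum_freqIndex, sum_freqIndex, ← hd] at hf
    have hgw : gevreyWeight (fun _ => α) a + ∑ l, gevreyWeight (Sum.elim (fun _ => β) (fun _ => α))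
        (freqIndex k a + Pi.single l N₀) ≤ d * ((N₀.factorial : ℝ) ^ β *
          (((2 : ℝ) ^ α) ^ (q + N₀) * ((q.factorial : ℝ) ^ α * (N₀.factorial : ℝ) ^ α))) := by
      have hadd := factorial_add_rpow_le hα q N₀
      have h0 : gevreyWeight (fun _ => α) a ≤
          (N₀.factorial : ℝ) ^ β * ((q + N₀).factorial : ℝ) ^ α := by
        refine (gevreyWeight_const_le hα a).trans ?_
        refine le_trans ?_ (le_mul_of_one_le_left (by positivity) (one_le_factorial_rpow hβ N₀))
        exact Real.rpow_le_rpow (by positivity)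
          (by exact_mod_cast Nat.factorial_le (Nat.le_add_right _ _)) hα
      have h2 := Finset.sum_le_card_nsmul Finset.univ _ _ fun l _ =>
        gevreyWeight_freqIndex_add_le (k := k) hα hβ a N₀ l
      rw [nsmul_eq_mul, Finset.card_univ] at h2
      have h3 : d * ((N₀.factorial : ℝ) ^ β * ((q + N₀).factorial : ℝ) ^ α) ≤
          d * ((N₀.factorial : ℝ) ^ β *
          (((2 : ℝ) ^ α) ^ (q + N₀) * ((q.factorial : ℝ) ^ α * (N₀.factorial : ℝ) ^ α))) := by
        gcongr
      refine le_trans ?_ h3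
      rw [hd, add_mul, one_mul, add_comm]
      exact add_le_add h2 h0
    have hgb := gevreyWeight_const_le hβ b
    have hwin := norm_multiDeriv_window_le hα hr hg c (negFst k n x + dirsL u z)
    have hqc := factorial_rpow_mul_le hα q mc
    have hw := le_mixedWeight (θ₁ := α) hβ (q + mc) m
    have hgwp : 0 ≤ gevreyWeight (fun _ => α) a +
        ∑ l, gevreyWeight (Sum.elim (fun _ => β) (fun _ => α))
        (freqIndex k a + Pi.single l N₀) :=
      add_nonneg (gevreyWeight_nonneg _ _) (Finset.sum_nonneg fun _ _ => gevreyWeight_nonneg _ _)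
    have pw : ∀ {X : ℝ}, 1 ≤ X → ∀ {i}, i ≤ e → X ^ i ≤ X ^ e := fun hX _ hi =>
      pow_le_pow_right₀ hX hi
    calc (1 + ‖x‖) ^ N₀ * (‖monoDeriv (freqIndex k a) (freqIndex k b) Φ x‖ *
          ‖multiDeriv c g (negFst k n x + dirsL u z)‖)
        = ((1 + ‖x‖) ^ N₀ * ‖monoDeriv (freqIndex k a) (freqIndex k b) Φ x‖) *
          ‖multiDeriv c g (negFst k n x + dirsL u z)‖ := by ring
      _ ≤ (d ^ N₀ * σ * A ^ (q + N₀ + m) * (m.factorial : ℝ) ^ β *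
          (d * ((N₀.factorial : ℝ) ^ β *
          (((2 : ℝ) ^ α) ^ (q + N₀) * ((q.factorial : ℝ) ^ α * (N₀.factorial : ℝ) ^ α))))) *
          (Mg * R ^ mc * (mc.factorial : ℝ) ^ α) := by
          refine mul_le_mul (hf.trans ?_) hwin (norm_nonneg _) (by positivity)
          gcongr
      _ = C₀ * σ * (A ^ (q + m) * ((2 : ℝ) ^ α) ^ q * R ^ mc) *
          (((q.factorial : ℝ) ^ α * (mc.factorial : ℝ) ^ α) * (m.factorial : ℝ) ^ β) := by
          rw [hC₀, show q + N₀ + m = q + m + N₀ by ring, pow_add A, pow_add _ q N₀]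
          ring
      _ ≤ C₀ * σ * (A ^ e * ((2 : ℝ) ^ α) ^ e * R ^ e) *
          (((q + mc).factorial : ℝ) ^ α * (m.factorial : ℝ) ^ β) := by
          have i3 := pw hA1 (show q + m ≤ e by omega)
          have i4 := pw hB1 (show q ≤ e by omega)
          have i5 := pw hR1 (show mc ≤ e by omega)
          gcongr
      _ = C₀ * σ * H ^ e * (((q + mc).factorial : ℝ) ^ α * (m.factorial : ℝ) ^ β) := by
          rw [hH, mul_pow, mul_pow]
      _ ≤ _ := by gcongr
  have := mul_norm_oscIntegral_le (negFst k n) (dirsL u) (freqPairing k n).flip zero_le_one hpt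
  rw [one_mul] at this
  refine this.trans (le_of_eq ?_)
  ring

variable {u}

lemma pderiv_synthesis {F : EuclideanSpace ℝ (Fin k ⊕ Fin n) → ℂ}
    {g : EuclideanSpace ℝ (Fin k) → ℂ} (hF : RapidDecay F) (hg : IsBump g) (l : Fin n) :
    pderiv l (synthesis u F g) =
      ∑ i, (dirsL u (EuclideanSpace.single l 1) i : ℂ) • synthesis u F (pderiv i g) +
      (2 * Real.pi * Complex.I : ℂ) • synthesis u (fun x => (x (Sum.inr l) : ℂ) * F x) g := by
  rw [synthesis, pderiv_oscIntegral _ _ _ hF hg]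
  simp only [ContinuousLinearMap.flip_apply, freqPairing_single_left]
  rfl

/-- The integration by parts is in ξ_j, on which the window does not depend, so no derivative falls
on g. -/
lemma abs_coord_mul_synthesis_le {a₀ : ℝ} (ha₀ : 0 < a₀)
    {Φ : EuclideanSpace ℝ (Fin k ⊕ Fin n) → ℂ} (hsm : ContDiff ℝ ∞ Φ) {γ δ : Fin k ⊕ Fin n → ℝ}
    (hΦ : gsNorm γ δ a₀ Φ < ⊤) {g : EuclideanSpace ℝ (Fin k) → ℂ} (hg : IsBump g)
    (a b : Fin k ⊕ Fin n → ℕ) (j : Fin n) (z : EuclideanSpace ℝ (Fin n)) :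
    |z j| * ‖synthesis u (monoDeriv a b Φ) g z‖ ≤
      a (Sum.inr j) * ‖synthesis u (monoDeriv (a - Pi.single (Sum.inr j) 1) b Φ) g z‖ +
      ‖synthesis u (monoDeriv a (b + Pi.single (Sum.inr j) 1) Φ) g z‖ := by
  have h := congrArg norm (coord_mul_oscIntegral (negFst k n) (dirsL u) (freqPairing k n).flip
    hsm ha₀ hΦ hg a b (Sum.inr j) z)
  rw [norm_mul, norm_mul, norm_two_pi_I, norm_neg, Complex.norm_real,
    ContinuousLinearMap.flip_apply, freqPairing_single_inr,
    Finset.sum_eq_zero (fun i _ => by simp [negFst_apply]), add_zero, Real.norm_eq_abs] at h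
  have h2 : |z j| * ‖synthesis u (monoDeriv a b Φ) g z‖ ≤
      2 * Real.pi * |z j| * ‖synthesis u (monoDeriv a b Φ) g z‖ := by
    have := one_le_two_pi
    have h0 : 0 ≤ |z j| * ‖synthesis u (monoDeriv a b Φ) g z‖ := by positivity
    nlinarith
  refine h2.trans (h.le.trans ?_)
  refine (norm_add_le _ _).trans (add_le_add (le_of_eq ?_) le_rfl)
  rw [norm_mul, Complex.norm_natCast]; rfl

/-- A derivative in t either multiplies by ξ or differentiates the window, and both raise M = |a| +
|c|; multiplication by t_j raises s = |b| or lowers |a| at the cost a_j. The degrees give |q|!^α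
|p|!^β up to geometric factors. -/
lemma exists_gsNorm_synthesis_le (hu : ∀ i, ‖u i‖ = 1) (hα : 0 ≤ α) (hβ : 0 ≤ β)
    (hαβ : 1 ≤ α + β) {r : ℝ} (hr : 0 < r)
    {g : EuclideanSpace ℝ (Fin k) → ℂ} (hgs : ContDiff ℝ ∞ g)
    (hg : gsNorm (fun _ => α) (fun _ => 0) r g < ⊤) {a₀ : ℝ} (ha₀ : 0 < a₀) :
    ∃ b C : ℝ, 0 < b ∧ 0 ≤ C ∧ ∀ Φ : EuclideanSpace ℝ (Fin k ⊕ Fin n) → ℂ, ContDiff ℝ ∞ Φ →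
      gsNorm (Sum.elim (fun _ => α) (fun _ => β)) (Sum.elim (fun _ => β) (fun _ => α)) a₀ Φ < ⊤ →
      gsNorm (fun _ => α) (fun _ => β) b (synthesis u Φ g) ≤
        ENNReal.ofReal (C * (gsNorm (Sum.elim (fun _ => α) (fun _ => β))
          (Sum.elim (fun _ => β) (fun _ => α)) a₀ Φ).toReal) := by
  wlog hr1 : r ≤ 1 generalizing r
  · exact this one_pos ((gsNorm_mono _ _ zero_le_one (not_le.1 hr1).le g).trans_lt hg) le_rfl
  wlog ha₁ : a₀ ≤ 1 generalizing a₀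
  · obtain ⟨b, C, hb, hC, h⟩ := this one_pos le_rfl
    refine ⟨b, C, hb, hC, fun Φ hsm hΦ => ?_⟩
    have hle := gsNorm_mono (Sum.elim (fun _ => α) (fun _ => β))
      (Sum.elim (fun _ => β) (fun _ => α)) zero_le_one (not_le.1 ha₁).le Φ
    refine (h Φ hsm (hle.trans_lt hΦ)).trans (ENNReal.ofReal_le_ofReal ?_)
    gcongr
    exact hΦ.ne
  obtain ⟨C, H, hC, hH, hbase⟩ := exists_synthesis_base (n := n) u hα hβ hr hr1 hg ha₀ ha₁
  have hgb := isBump_multiDeriv hgs hr hg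
  set X : ℝ := ((2 : ℝ) ^ (n + 1)) ^ (α + β) with hX
  have hX1 : 1 ≤ X := Real.one_le_rpow (one_le_pow₀ (by norm_num)) (by linarith)
  have hXβ : (2 : ℝ) ^ β ≤ X := by
    simpa using two_pow_rpow_le hβ (by linarith : β ≤ α + β) (show 1 ≤ n + 1 by omega)
  set D : ℝ := 2 * Real.pi * Fintype.card (Option (Fin k)) with hD
  have h2π := one_le_two_pi
  have hD1 : 1 ≤ D := by
    refine one_le_mul_of_one_le_of_one_le h2π ?_
    exact_mod_cast Fintype.card_pos
  -- D bounds the loss per derivative, 2 is the number of terms per multiplication by t_j, H comes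
  -- from the base estimate, and X enters once for each of `w1`, `g1`, `g2`.
  set B : ℝ := D * 2 * H * X ^ 3 with hB
  have hB0 : 0 < B := by positivity
  refine ⟨B⁻¹, C, inv_pos.2 hB0, hC, fun Φ hsm hΦ => ?_⟩
  set σ := (gsNorm (Sum.elim (fun _ => α) (fun _ => β))
    (Sum.elim (fun _ => β) (fun _ => α)) a₀ Φ).toReal with hσ
  have hσ0 : 0 ≤ σ := ENNReal.toReal_nonneg
  have hfd := rapidDecay_monoDeriv hsm ha₀ hΦ
  refine gsNorm_le_of_norm_monoDeriv_le (inv_pos.2 hB0) fun p q z => ?_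
  rw [inv_inv]
  let S := (Fin n → ℕ) × (Fin n → ℕ) × (Fin k → ℕ)
  let Θ : S → EuclideanSpace ℝ (Fin n) → ℂ := fun s =>
    synthesis u (monoDeriv (freqIndex k s.1) (freqIndex k s.2.1) Φ) (multiDeriv s.2.2 g)
  set P := ∑ i, p i with hP
  set Q := ∑ i, q i with hQ
  obtain ⟨v, hv⟩ := exists_list_count p
  have hmon : |monomial p z| = (v.map fun j => |z j|).prod := by
    rw [prod_map_eq_of_count hv, monomial, Finset.abs_prod]
    simp only [abs_pow]
  have hvl : v.length = P := length_eq_of_count hv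
  have hmul : ∀ s : S, |monomial p z| * ‖Θ s z‖ ≤ C * σ * 2 ^ P *
      H ^ (P + (((∑ i, s.1 i) + ∑ i, s.2.2 i) + ∑ i, s.2.1 i)) *
      mixedWeight α β ((∑ i, s.1 i) + ∑ i, s.2.2 i) (P + ∑ i, s.2.1 i) := by
    intro s
    have h := list_prod_mul_le_mixedWeight (I := Unit) hα hβ hαβ
      (fun s : S => ‖Θ s z‖) (fun s => (∑ i, s.1 i) + ∑ i, s.2.2 i)
      (fun s => ∑ i, s.2.1 i) (fun j => |z j|)
      (fun j => abs_nonneg _) (by positivity) hH (fun s => hbase Φ hΦ s.1 s.2.1 s.2.2 z)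
      (fun s j => ⟨s.1 j, (s.1 - Pi.single j 1, s.2.1, s.2.2), fun _ =>
        (s.1, s.2.1 + Pi.single j 1, s.2.2), ?_, ?_, ?_⟩) v s
    · rw [Fintype.card_unit, Nat.cast_one, one_add_one_eq_two] at h
      rw [hmon, ← hvl]
      exact h
    · have h := abs_coord_mul_synthesis_le (u := u) ha₀ hsm hΦ
        (hgb s.2.2) (freqIndex k s.1) (freqIndex k s.2.1) j z
      rw [freqIndex_add_single, freqIndex_sub_single] at h
      simpa [Θ, freqIndex] using h
    · by_cases h0 : s.1 j = 0
      · exact Or.inl h0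
      · refine Or.inr ⟨?_, ?_, rfl⟩
        · have := sum_sub_single h0
          simp only
          omega
        · have := Finset.single_le_sum (f := s.1) (fun _ _ => Nat.zero_le _) (Finset.mem_univ j)
          omega
    · intro _
      simp only [sum_add_single]
      exact ⟨trivial, trivial⟩
  obtain ⟨w, hw, hwd⟩ := exists_multiDeriv_eq_wordDeriv q
  have hder := norm_wordDeriv_le (I := Option (Fin k)) Θ
    (fun s => oscIntegral_contDiff _ _ _ (hfd _ _) (hgb s.2.2))
    (fun s => (∑ i, s.1 i) + ∑ i, s.2.2 i) (fun s => ∑ i, s.2.1 i)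
    (fun _ => 1) (fun _ => 0) (D := 2 * Real.pi) (by positivity)
    (fun s l => by
      refine ⟨fun o => o.elim (2 * Real.pi * Complex.I)
        fun i => (dirsL u (EuclideanSpace.single l 1) i : ℂ),
        fun o => o.elim (s.1 + Pi.single l 1, s.2.1, s.2.2)
          fun i => (s.1, s.2.1, s.2.2 + Pi.single i 1), ?_, ?_⟩
      · rw [Fintype.sum_option, add_comm]
        simp only [Option.elim_none, Option.elim_some, Θ]
        rw [pderiv_synthesis (hfd _ _) (hgb _)]
        simp only [coord_mul_monoDeriv, freqIndex_add_single, pderiv_multiDeriv _ _ hgs]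
      · rintro (_ | i)
        · simp only [Option.elim_none, sum_add_single]
          exact ⟨norm_two_pi_I.le, by omega, rfl⟩
        · simp only [Option.elim_some, sum_add_single]
          refine ⟨?_, by omega, rfl⟩
          rw [Complex.norm_real]
          refine le_trans ?_ h2π
          simpa using abs_dirsL_le hu (EuclideanSpace.single l 1) i)
    (z := z) (abs_nonneg (monomial p z))
    (fun M s => C * σ * 2 ^ P * H ^ (P + (M + s)) * mixedWeight α β M (P + s))
    hmul w (0, 0, 0)
  have hf0 : freqIndex k (0 : Fin n → ℕ) = 0 := by
    funext l; rcases l with i | i <;> rfl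
  have hΘ0 : Θ (0, 0, 0) = synthesis u Φ g := by simp [Θ, hf0]
  rw [hΘ0, ← hwd, ← norm_monoDeriv, length_eq_of_count hw, sum_map_eq_of_count hw,
    sum_map_eq_of_count hw] at hder
  simp only [mul_zero, mul_one, Finset.sum_const_zero, add_zero, zero_add, Pi.zero_apply] at hder
  rw [← hQ, ← hD] at hder
  refine hder.trans ?_
  set N := P + Q with hN
  have w1 := mixedWeight_le_of_le (θ₁ := α) hβ hX1 hXβ (show Q + P ≤ N by omega)
  have cX : ∀ {γ : ℝ}, 0 ≤ γ → γ ≤ α + β →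
      ((2 : ℝ) ^ Fintype.card (Fin n)) ^ γ ≤ X := fun h1 h2 =>
    two_pow_rpow_le h1 h2 (by simp)
  have g1 := factorial_rpow_le_gevreyWeight (N := N) hβ hX1 (cX hβ (by linarith)) p (by omega)
  have g2 := factorial_rpow_le_gevreyWeight (N := N) hα hX1 (cX hα (by linarith)) q (by omega)
  have n1 := gevreyWeight_nonneg (fun _ => β) p
  have n2 := gevreyWeight_nonneg (fun _ => α) q
  rw [← hP] at g1
  rw [← hQ] at g2
  have hmix : mixedWeight α β Q P ≤ X ^ N *
      ((X ^ N * gevreyWeight (fun _ => α) q) * (X ^ N * gevreyWeight (fun _ => β) p)) := by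
    refine w1.trans ?_
    gcongr
  calc D ^ Q * (C * σ * 2 ^ P * H ^ (P + Q) * mixedWeight α β Q P)
      ≤ D ^ N * (C * σ * 2 ^ N * H ^ N * (X ^ N *
      ((X ^ N * gevreyWeight (fun _ => α) q) * (X ^ N * gevreyWeight (fun _ => β) p)))) := by
        have i1 : D ^ Q ≤ D ^ N := pow_le_pow_right₀ hD1 (by omega)
        have i2 : (2 : ℝ) ^ P ≤ 2 ^ N := pow_le_pow_right₀ (by norm_num) (by omega)
        have := mixedWeight_nonneg α β Q P
        gcongr
    _ = _ := by
        have hBN : B ^ N = D ^ N * 2 ^ N * H ^ N * (X ^ N) ^ 3 := by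
          rw [hB, mul_pow, mul_pow, mul_pow, ← pow_mul X 3 N, mul_comm 3 N, pow_mul X N 3]
        rw [hBN]
        ring

end Synthesis

/-! ### Continuity on the inductive limit. -/

section InductiveLimit

variable {ι κ : Type} [Fintype ι] [DecidableEq ι] [Fintype κ] [DecidableEq κ]
  {α β : ι → ℝ} {α' β' : κ → ℝ}

/-- The inductive limit topology is an infimum of admissible topologies and is itself admissible on
each step: its neighbourhood filter at 0 is the infimum of theirs, and each contains the filter of
norm balls. -/
lemma exists_gsNorm_lt_mem_of_mem_nhds_zero {a : ℝ} (ha : 0 < a) {U : Set (GSSpace α β)}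
    (hU : U ∈ nhds (0 : GSSpace α β)) :
    ∃ δ : ℝ≥0∞, 0 < δ ∧ ∀ φ : GSSpace α β, gsNorm α β a φ < δ → φ ∈ U := by
  have key : Filter.comap (fun φ : GSSpace α β => gsNorm α β a φ) (nhds 0) ≤
      nhds (0 : GSSpace α β) := by
    refine le_of_le_of_eq ?_ (nhds_sInf (s := _) (a := (0 : GSSpace α β))).symm
    refine le_iInf₂ fun τ hτ V hV => ?_
    obtain ⟨δ, hδ, h⟩ := hτ.1 a ha V hV
    exact ⟨Set.Iio δ, Iio_mem_nhds hδ, fun φ hφ => h φ hφ⟩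
  obtain ⟨δ, hδ, h⟩ := (ENNReal.nhds_zero_basis.comap _).mem_iff.1 (key hU)
  exact ⟨δ, hδ, fun φ hφ => h hφ⟩

/-- A linear map between inductive limits is continuous if it maps steps boundedly to steps. -/
lemma continuous_of_gsNorm_le (L : GSSpace α β →ₗ[ℂ] GSSpace α' β')
    (hL : ∀ a : ℝ, 0 < a → ∃ b C : ℝ, 0 < b ∧ 0 ≤ C ∧ ∀ φ : GSSpace α β, gsNorm α β a φ < ⊤ →
      gsNorm α' β' b (L φ) ≤ ENNReal.ofReal (C * (gsNorm α β a φ).toReal)) :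
    Continuous L := by
  rw [continuous_iff_le_induced]
  -- The topology pulled back along L is one of those over which the infimum is taken, provided that
  -- it makes the inclusions of the steps continuous.
  refine sInf_le ⟨fun a ha U hU => ?_, topologicalAddGroup_induced L, continuousSMul_induced L,
    LocallyConvexSpace.induced (L.restrictScalars ℝ)⟩
  rw [nhds_induced, map_zero] at hU
  obtain ⟨V, hV, hVU⟩ := hU
  obtain ⟨b, C, hb, hC, h⟩ := hL a ha
  obtain ⟨ε, hε, hεV⟩ := exists_gsNorm_lt_mem_of_mem_nhds_zero hb hV
  have hc : ENNReal.ofReal C + 1 ≠ ⊤ := ENNReal.add_ne_top.2 ⟨ENNReal.ofReal_ne_top, by simp⟩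
  -- The bound 1 makes the norm of φ finite, so the hypothesis applies; C + 1 keeps the divisor
  -- positive.
  refine ⟨min 1 (ε / (ENNReal.ofReal C + 1)),
    lt_min one_pos (ENNReal.div_pos hε.ne' hc), fun φ hφ => hVU (hεV _ ?_)⟩
  have h1 : gsNorm α β a φ < ⊤ := (hφ.trans_le (min_le_left _ _)).trans ENNReal.one_lt_top
  have h2 := ENNReal.mul_lt_of_lt_div (hφ.trans_le (min_le_right _ _))
  refine lt_of_le_of_lt ?_ h2
  refine (h φ h1).trans ?_
  rw [ENNReal.ofReal_mul hC, ENNReal.ofReal_toReal h1.ne, mul_comm]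
  gcongr
  exact le_self_add

end InductiveLimit

/-! ### Conjugation of the window preserves the norms. -/

section Conjugation

variable {ι : Type} [Fintype ι] [DecidableEq ι]

lemma pderiv_conjFun (i : ι) (g : EuclideanSpace ℝ ι → ℂ) :
    pderiv i (conjFun g) = conjFun (pderiv i g) := by
  funext t
  have : conjFun g = Complex.conjCLE ∘ g := rfl
  rw [pderiv, this, Complex.conjCLE.comp_fderiv]
  rfl

lemma multiDeriv_conjFun (q : ι → ℕ) (g : EuclideanSpace ℝ ι → ℂ) :
    multiDeriv q (conjFun g) = conjFun (multiDeriv q g) := by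
  have key : ∀ (w : List ι) (g : EuclideanSpace ℝ ι → ℂ),
      wordDeriv w (conjFun g) = conjFun (wordDeriv w g) := by
    intro w
    induction w with
    | nil => exact fun g => rfl
    | cons i w ih => intro g; rw [wordDeriv, pderiv_conjFun, ih]; rfl
  obtain ⟨w, -, hw⟩ := exists_multiDeriv_eq_wordDeriv q
  rw [hw, hw, key]

lemma gsNorm_conjFun (α β : ι → ℝ) (a : ℝ) (g : EuclideanSpace ℝ ι → ℂ) :
    gsNorm α β a (conjFun g) = gsNorm α β a g := by
  have : ∀ q t, ‖multiDeriv q (conjFun g) t‖ = ‖multiDeriv q g t‖ := by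
    intro q t
    rw [multiDeriv_conjFun]
    exact RCLike.norm_conj _
  simp only [gsNorm, this]

lemma contDiff_conjFun {g : EuclideanSpace ℝ ι → ℂ} (hg : ContDiff ℝ ∞ g) :
    ContDiff ℝ ∞ (conjFun g) :=
  Complex.conjCLE.contDiff.comp hg

end Conjugation

/-! ### Identification of the oscillatory integrals with the transform and the synthesis operator.
-/

section Identification

open MeasureTheory

variable {k n : ℕ} (u : Fin k → EuclideanSpace ℝ (Fin n))

lemma negFst_pair (y : EuclideanSpace ℝ (Fin k)) (ξ : EuclideanSpace ℝ (Fin n)) :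
    negFst k n (pair y ξ) = -y := by
  ext i
  simp [negFst_apply, pair]

lemma freqPairing_pair (t ξ : EuclideanSpace ℝ (Fin n)) (y : EuclideanSpace ℝ (Fin k)) :
    freqPairing k n t (pair y ξ) = inner ℝ t ξ := by
  simp [freqPairing_apply, pair, PiLp.inner_apply, mul_comm]

lemma oscIntegrand_analysis (g : EuclideanSpace ℝ (Fin k) → ℂ)
    (f : EuclideanSpace ℝ (Fin n) → ℂ) (y : EuclideanSpace ℝ (Fin k))
    (ξ : EuclideanSpace ℝ (Fin n)) :
    oscIntegrand (dirsL u) (negFst k n) (-freqPairing k n) f g (pair y ξ) =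
      dstftIntegrand (conjFun g) u f y ξ := by
  funext t
  simp [oscIntegrand, dstftIntegrand, conjFun, negFst_pair, dirsL_eq_dirs, freqPairing_pair,
    unitExp, sub_eq_add_neg]

lemma oscIntegrand_synthesis (g : EuclideanSpace ℝ (Fin k) → ℂ)
    (F : EuclideanSpace ℝ (Fin k ⊕ Fin n) → ℂ) (t : EuclideanSpace ℝ (Fin n))
    (y : EuclideanSpace ℝ (Fin k)) (ξ : EuclideanSpace ℝ (Fin n)) :
    oscIntegrand (negFst k n) (dirsL u) (freqPairing k n).flip F g t (pair y ξ) =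
      dsoIntegrand g u F t y ξ := by
  simp [oscIntegrand, dsoIntegrand, negFst_pair, dirsL_eq_dirs, freqPairing_pair,
    unitExp, sub_eq_add_neg, add_comm, real_inner_comm]

/-- `pair` as a measurable equivalence. -/
noncomputable def pairEquiv (k n : ℕ) :
    EuclideanSpace ℝ (Fin k) × EuclideanSpace ℝ (Fin n) ≃ᵐ EuclideanSpace ℝ (Fin k ⊕ Fin n) :=
  ((MeasurableEquiv.prodCongr (MeasurableEquiv.toLp 2 (Fin k → ℝ)).symm
    (MeasurableEquiv.toLp 2 (Fin n → ℝ)).symm).trans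
      (MeasurableEquiv.sumPiEquivProdPi fun _ : Fin k ⊕ Fin n => ℝ).symm).trans
    (MeasurableEquiv.toLp 2 (Fin k ⊕ Fin n → ℝ))

lemma pairEquiv_apply (z : EuclideanSpace ℝ (Fin k) × EuclideanSpace ℝ (Fin n)) :
    pairEquiv k n z = pair z.1 z.2 := by
  ext i
  rcases i with i | i <;> rfl

lemma measurePreserving_pairEquiv : MeasurePreserving (pairEquiv k n) :=
  (PiLp.volume_preserving_toLp (Fin k ⊕ Fin n)).comp
    ((volume_measurePreserving_sumPiEquivProdPi_symm fun _ : Fin k ⊕ Fin n => ℝ).comp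
      ((PiLp.volume_preserving_ofLp (Fin k)).prod (PiLp.volume_preserving_ofLp (Fin n))))

lemma integrable_dsoIntegrand {F : EuclideanSpace ℝ (Fin k ⊕ Fin n) → ℂ} (hF : RapidDecay F)
    {g : EuclideanSpace ℝ (Fin k) → ℂ} (hg : IsBump g) (t : EuclideanSpace ℝ (Fin n)) :
    Integrable (fun z : EuclideanSpace ℝ (Fin k) × EuclideanSpace ℝ (Fin n) =>
      dsoIntegrand g u F t z.1 z.2) := by
  have h := (measurePreserving_pairEquiv.integrable_comp_emb
    (pairEquiv k n).measurableEmbedding).2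
    (integrable_oscIntegrand (negFst k n) (dirsL u) (freqPairing k n).flip hF hg t)
  refine h.congr (Filter.Eventually.of_forall fun z => ?_)
  rw [Function.comp_apply, pairEquiv_apply, oscIntegrand_synthesis]

/-- The volume on ℝ^(k+n) is carried to the product measure by a measure-preserving splitting of
coordinates; absolute integrability then permits Fubini, with y as the inner variable. -/
lemma synthesis_eq_dso {F : EuclideanSpace ℝ (Fin k ⊕ Fin n) → ℂ} (hF : RapidDecay F)
    {g : EuclideanSpace ℝ (Fin k) → ℂ} (hg : IsBump g) (t : EuclideanSpace ℝ (Fin n)) :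
    synthesis u F g t = dso g u F t := by
  rw [synthesis, oscIntegral, ← measurePreserving_pairEquiv.integral_comp', dso]
  simp only [pairEquiv_apply, oscIntegrand_synthesis]
  exact integral_prod_symm _ (integrable_dsoIntegrand u hF hg t)

lemma rapidDecay_of_mem {ι : Type} [Fintype ι] [DecidableEq ι] {α β : ι → ℝ}
    (φ : GSSpace α β) : RapidDecay φ := by
  obtain ⟨a, ha, hsm, hφ⟩ := φ.2
  simpa using rapidDecay_monoDeriv hsm ha hφ 0 0

lemma contDiff_of_mem {ι : Type} [Fintype ι] [DecidableEq ι] {α β : ι → ℝ}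
    (φ : GSSpace α β) : ContDiff ℝ ∞ φ := by
  obtain ⟨a, ha, hsm, hφ⟩ := φ.2
  exact hsm

end Identification

/-- A linear operator on functions, bounded from steps to steps, as a continuous linear map of
Gelfand–Shilov spaces. -/
lemma exists_continuousLinearMap {ι κ : Type} [Fintype ι] [DecidableEq ι] [Fintype κ]
    [DecidableEq κ] {α β : ι → ℝ} {α' β' : κ → ℝ}
    (T : (EuclideanSpace ℝ ι → ℂ) → EuclideanSpace ℝ κ → ℂ)
    (hadd : ∀ φ ψ : GSSpace α β, T ((φ : EuclideanSpace ℝ ι → ℂ) + (ψ : EuclideanSpace ℝ ι → ℂ)) =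
      T φ + T ψ)
    (hsmul : ∀ (c : ℂ) (φ : GSSpace α β), T (c • (φ : EuclideanSpace ℝ ι → ℂ)) = c • T φ)
    (hsm : ∀ φ : GSSpace α β, ContDiff ℝ ∞ (T φ))
    (hT : ∀ a : ℝ, 0 < a → ∃ b C : ℝ, 0 < b ∧ 0 ≤ C ∧ ∀ φ : EuclideanSpace ℝ ι → ℂ,
      ContDiff ℝ ∞ φ → gsNorm α β a φ < ⊤ →
      gsNorm α' β' b (T φ) ≤ ENNReal.ofReal (C * (gsNorm α β a φ).toReal)) :
    ∃ L : GSSpace α β →L[ℂ] GSSpace α' β', ∀ (φ : GSSpace α β) z, L φ z = T φ z := by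
  have hmem : ∀ φ : GSSpace α β, T φ ∈ gsSubmodule α' β' := by
    intro φ
    obtain ⟨a, ha, hφ, hfin⟩ := φ.2
    obtain ⟨b, C, hb, -, h⟩ := hT a ha
    exact ⟨b, hb, hsm φ, (h _ hφ hfin).trans_lt ENNReal.ofReal_lt_top⟩
  let L : GSSpace α β →ₗ[ℂ] GSSpace α' β' :=
    { toFun := fun φ => ⟨T φ, hmem φ⟩
      map_add' := fun φ ψ => Subtype.ext (hadd φ ψ)
      map_smul' := fun c φ => Subtype.ext (hsmul c φ) }
  have hL : Continuous L := continuous_of_gsNorm_le L fun a ha => by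
    obtain ⟨b, C, hb, hC, h⟩ := hT a ha
    exact ⟨b, C, hb, hC, fun φ hφ => h _ (contDiff_of_mem φ) hφ⟩
  exact ⟨⟨L, hL⟩, fun φ z => rfl⟩

end GelfandShilov

/-! ### The operators on test functions and their transposes. -/

theorem mainTheorem7 (k n : ℕ) (hk : 1 ≤ k) (α β : ℝ) (hα : 0 < α) (hβ : 0 < β)
    (u : Fin k → EuclideanSpace ℝ (Fin n)) (hu : ∀ i, ‖u i‖ = 1)
    (hlin : LinearIndependent ℝ u) (g : GelfandShilov.GS k α 0) :
    ∃ (V : GelfandShilov.GS n α β →L[ℂ] GelfandShilov.PhaseGS k n α β)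
      (W : GelfandShilov.PhaseGS k n α β →L[ℂ] GelfandShilov.GS n α β),
      -- `V` is the transform `DS` on test functions with window `ḡ`
      (∀ (φ : GelfandShilov.GS n α β) (y : EuclideanSpace ℝ (Fin k))
          (ξ : EuclideanSpace ℝ (Fin n)),
        MeasureTheory.Integrable
          (GelfandShilov.dstftIntegrand (GelfandShilov.conjFun g) u φ y ξ) ∧
        V φ (GelfandShilov.pair y ξ) =
          GelfandShilov.dstft (GelfandShilov.conjFun g) u φ y ξ) ∧
      -- `W` is the synthesis operator on test functions with window `ḡ`
      (∀ (Φ : GelfandShilov.PhaseGS k n α β) (t : EuclideanSpace ℝ (Fin n)),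
        MeasureTheory.Integrable
          (fun z : EuclideanSpace ℝ (Fin k) × EuclideanSpace ℝ (Fin n) =>
            GelfandShilov.dsoIntegrand (GelfandShilov.conjFun g) u Φ t z.1 z.2) ∧
        W Φ t = GelfandShilov.dso (GelfandShilov.conjFun g) u Φ t) ∧
      -- the transform on ultradistributions is continuous and linear for the strong topologies
      (∃ DS : StrongDual ℂ (GelfandShilov.GS n α β) →L[ℂ]
            StrongDual ℂ (GelfandShilov.PhaseGS k n α β),
        ∀ (f : StrongDual ℂ (GelfandShilov.GS n α β)) (Φ : GelfandShilov.PhaseGS k n α β),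
          DS f Φ = f (W Φ)) ∧
      -- so is the synthesis operator on ultradistributions
      (∃ DSO : StrongDual ℂ (GelfandShilov.PhaseGS k n α β) →L[ℂ]
            StrongDual ℂ (GelfandShilov.GS n α β),
        ∀ (F : StrongDual ℂ (GelfandShilov.PhaseGS k n α β)) (φ : GelfandShilov.GS n α β),
          DSO F φ = F (V φ)) := by
  open GelfandShilov in
  obtain ⟨r, hr, hgs, hgr⟩ := g.2
  have hgcs : ContDiff ℝ ∞ (conjFun g) := contDiff_conjFun hgs
  have hgcr : gsNorm (fun _ => α) (fun _ => 0) r (conjFun g) < ⊤ := by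
    rw [gsNorm_conjFun]; exact hgr
  have hg : IsBump g := by simpa using isBump_multiDeriv hgs hr hgr 0
  have hgc : IsBump (conjFun g) := by simpa using isBump_multiDeriv hgcs hr hgcr 0
  -- The condition k ≥ 1 enters through the vanishing of windows of regularity α ≤ 1.
  have : Nonempty (Fin k) := ⟨⟨0, hk⟩⟩
  -- The transform conjugates its window, so window ḡ means that g itself appears in the integral;
  -- in the synthesis operator ḡ appears unchanged.
  obtain ⟨V, hV⟩ := exists_continuousLinearMap (α := fun _ => α) (β := fun _ => β)
    (α' := Sum.elim (fun _ => α) (fun _ => β)) (β' := Sum.elim (fun _ => β) (fun _ => α))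
    (fun φ => analysis u φ g)
    (fun φ ψ => oscIntegral_add_left _ _ _ (rapidDecay_of_mem φ) (rapidDecay_of_mem ψ) hg)
    (fun c φ => oscIntegral_smul_left _ _ _ c _ _)
    (fun φ => oscIntegral_contDiff _ _ _ (rapidDecay_of_mem φ) hg)
    (fun a ha => by
      -- For α ≤ 1 the window is zero and any step with constant 0 works; for α ≥ 1 the condition α
      -- + β ≥ 1 of the main estimate holds.
      rcases le_total α 1 with h1 | h1
      · have hg0 := eq_zero_of_regularity_le_one h1 hgs hr hgr
        refine ⟨1, 0, one_pos, le_rfl, fun φ _ _ => ?_⟩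
        have : analysis u φ (0 : EuclideanSpace ℝ (Fin k) → ℂ) = 0 := oscIntegral_zero_right _ _ _ _
        rw [hg0, this, gsNorm_zero]
        exact zero_le
      · exact exists_gsNorm_analysis_le hu hα.le hβ.le (by linarith) hr hgs hgr ha)
  obtain ⟨W, hW⟩ := exists_continuousLinearMap (α' := fun _ => α) (β' := fun _ => β)
    (α := Sum.elim (fun _ => α) (fun _ => β)) (β := Sum.elim (fun _ => β) (fun _ => α))
    (fun Φ => synthesis u Φ (conjFun g))
    (fun φ ψ => oscIntegral_add_left _ _ _ (rapidDecay_of_mem φ) (rapidDecay_of_mem ψ) hgc)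
    (fun c φ => oscIntegral_smul_left _ _ _ c _ _)
    (fun φ => oscIntegral_contDiff _ _ _ (rapidDecay_of_mem φ) hgc)
    (fun a ha => by
      rcases le_total α 1 with h1 | h1
      · have hg0 := eq_zero_of_regularity_le_one h1 hgcs hr hgcr
        refine ⟨1, 0, one_pos, le_rfl, fun φ _ _ => ?_⟩
        have : synthesis u φ (0 : EuclideanSpace ℝ (Fin k) → ℂ) = 0 :=
          oscIntegral_zero_right _ _ _ _
        rw [hg0, this, gsNorm_zero]
        exact zero_le
      · exact exists_gsNorm_synthesis_le hu hα.le hβ.le (by linarith) hr hgcs hgcr ha)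
  refine ⟨V, W, fun φ y ξ => ⟨?_, ?_⟩, fun Φ t => ⟨?_, ?_⟩, ?_, ?_⟩
  · rw [← oscIntegrand_analysis]
    exact integrable_oscIntegrand _ _ _ (rapidDecay_of_mem φ) hg _
  · rw [hV, dstft, ← oscIntegrand_analysis]
    rfl
  · exact integrable_dsoIntegrand u (rapidDecay_of_mem Φ) hgc t
  · rw [hW]
    exact synthesis_eq_dso u (rapidDecay_of_mem Φ) hgc t
  -- Precomposition with a continuous linear map is strongly continuous, since such a map sends
  -- bounded sets to bounded sets.
  · exact ⟨ContinuousLinearMap.precomp ℂ W, fun f Φ => rfl⟩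
  · exact ⟨ContinuousLinearMap.precomp ℂ V, fun F φ => rfl⟩
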